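/- All graphs are finite and simple. A \emph{mass} on a graph $G$ is a function $\mu:2^{V(G)}\to\mathbb{R}$ with $\mu(\emptyset)=0$, $\mu(V(G))=1$, $\mu(X)\le\mu(Y)$ whenever $X\subseteq Y\subseteq V(G)$, and $\mu(X\cup Y)\le\mu(X)+\mu(Y)$ for all $X,Y\subseteq V(G)$; the pair $(G,\mu)$ is then a \emph{massed graph}. For $\epsilon>0$ it is \emph{$\epsilon$-coherent} if $\mu(\{v\})<\epsilon$ and $\mu(N(v))<\epsilon$ for every vertex $v$ (where $N(v)$ is the set of neighbours of $v$), and $\min\{\mu(A),\mu(B)\}<\epsilon$ for all disjoint $A,B\subseteq V(G)$ with no edge of $G$ between $A$ and $B$. For $\delta>0$ and an integer $r\ge 1$ it is \emph{$(\delta,r)$-focused} if for every $Z\subseteq V(G)$ with $\mu(Z)\ge\delta$ there is $v\in Z$ with $\mu(N^r_{G[Z]}[v])\ge\mu(Z)/2$, where $N^r_{G[Z]}[v]$ is the set of vertices at distance at most $r$ from $v$ in the induced subgraph $G[Z]$. A \emph{fuzzy odd path} is a graph obtained from a path of odd length by possibly adding one additional edge $uv$ between two internal vertices of the path such that $uv$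 is contained in a triangle of the resulting graph; its length and its ends are those of the underlying path. A \emph{proper fuzzy odd subdivision} of a graph $H$ is a graph obtained from $H$ by replacing each edge $ab$ of $H$ with a fuzzy odd path of length more than one with ends $a$ and $b$ (the replacing paths being disjoint apart from common ends). \textbf{Lemma.} For every graph $H$ and every integer $r\ge 1$ there exist $\epsilon,\delta>0$ such that, for every massed graph $(G,\mu)$ that is $(\delta,r)$-focused and $\epsilon$-coherent, $G$ contains a proper fuzzy odd subdivision of $H$ as an induced subgraph. -/

import Mathlib

/-- Two vertex sets are anticomplete if they are disjoint and no edge joins them. -/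
def Anticomplete {V : Type*} (G : SimpleGraph V) (A B : Set V) : Prop :=
  Disjoint A B ∧ ∀ a ∈ A, ∀ b ∈ B, ¬ G.Adj a b

/-- A mass on (a graph with) vertex set `V`: a normalised, monotone, subadditive real-valued
set function. -/
structure IsMass {V : Type*} (μ : Set V → ℝ) : Prop where
  empty : μ ∅ = 0
  univ : μ Set.univ = 1
  mono : ∀ X Y : Set V, X ⊆ Y → μ X ≤ μ Y
  union_le : ∀ X Y : Set V, μ (X ∪ Y) ≤ μ X + μ Y

/-- `ε`-coherence of the massed graph `(G, μ)`. -/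
structure IsCoherent {V : Type*} (G : SimpleGraph V) (μ : Set V → ℝ) (ε : ℝ) : Prop where
  singleton_lt : ∀ v : V, μ {v} < ε
  neighborSet_lt : ∀ v : V, μ (G.neighborSet v) < ε
  anticomplete_lt : ∀ A B : Set V, Anticomplete G A B → min (μ A) (μ B) < ε

/-- The set of all vertices at distance at most `r` from `v` in `G`. The extended distance is
used, so vertices in other components are at distance `⊤` and do not belong to it. -/
def closedNhd {V : Type*} (G : SimpleGraph V) (r : ℕ) (v : V) : Set V :=
  {w | G.edist v w ≤ (r : ℕ∞)}

/-- `(δ, r)`-focusedness of `(G, μ)`: every `Z` of mass at least `δ` contains a vertex `v` such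
that at least half of the mass of `Z` is within distance `r` of `v` in the induced subgraph
`G[Z]`. -/
def IsFocused {V : Type*} (G : SimpleGraph V) (μ : Set V → ℝ) (δ : ℝ) (r : ℕ) : Prop :=
  ∀ Z : Set V, δ ≤ μ Z →
    ∃ v : Z, μ Z / 2 ≤ μ (Subtype.val '' closedNhd (G.induce Z) r v)

/-- The subgraph `F` of `J` is a fuzzy odd path of length `n` between `s` and `t`: it consists
of an `s`-`t` path of odd length `n`, possibly with one additional edge `uv` joining two internal
vertices of the path and lying in a triangle. (The third vertex `w` of the triangle differs
from `u` and `v`, so `uw` and `wv` are edges of the path.) -/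
def IsFuzzyOddPath {U : Type*} {J : SimpleGraph U} (F : J.Subgraph) (s t : U) (n : ℕ) : Prop :=
  ∃ p : J.Walk s t, p.IsPath ∧ p.length = n ∧ Odd n ∧
    (F = p.toSubgraph ∨
      ∃ (u v w : U) (huv : J.Adj u v),
        u ∈ p.support ∧ u ≠ s ∧ u ≠ t ∧ v ∈ p.support ∧ v ≠ s ∧ v ≠ t ∧
        ¬ p.toSubgraph.Adj u v ∧ p.toSubgraph.Adj u w ∧ p.toSubgraph.Adj w v ∧
        F = p.toSubgraph ⊔ J.subgraphOfAdj huv)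

/-- `J` is a proper fuzzy odd subdivision of `H`: it is obtained from `H` by replacing each edge
`ab` by a fuzzy odd path of length more than one between (the copies of) `a` and `b`. The
replacing paths meet the original vertices, and each other, only as prescribed, and `J` has no
further vertices or edges. -/
def IsProperFuzzyOddSubdivision {U W : Type*} (J : SimpleGraph U) (H : SimpleGraph W) : Prop :=
  ∃ (φ : W ↪ U) (P : H.edgeSet → J.Subgraph),
    (∀ (a b : W) (h : H.Adj a b), ∃ n : ℕ, 1 < n ∧ IsFuzzyOddPath (P ⟨s(a, b), h⟩) (φ a) (φ b) n) ∧
    (∀ (e : H.edgeSet) (w : W), φ w ∈ (P e).verts → w ∈ (e : Sym2 W)) ∧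
    (∀ e f : H.edgeSet, e ≠ f → (P e).verts ∩ (P f).verts ⊆ Set.range φ) ∧
    (∀ x : U, x ∈ Set.range φ ∨ ∃ e : H.edgeSet, x ∈ (P e).verts) ∧
    (∀ x y : U, J.Adj x y → ∃ e : H.edgeSet, (P e).Adj x y)

/-! The proof grows a large supply of pairwise anticomplete covers of one massive set `M`, plants
the branch vertices of `H` in `M`, and then spends two covers per edge of `H` on an odd route.

Supply of covers. In a massive set `Z`, focusedness gives a ball of radius `r` holding half of the
mass, and by coherence its neighbours fill almost all of any other massive set. At the first radius
where this reach becomes substantial, the previous ball is a connected core and part of the next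
shell forms the leaves (`exists_core_and_leaves`). Starting from `2 ^ k` disjoint blocks, the block
with fewest covers is repeatedly sacrificed to give another block one more cover. The sum of `2 ^
(number of covers)` never drops, so the last block has at least `k` covers
(`CoverSystem.exists_single`).

Separation. Covers can be thinned, at a bounded factor in mass and half of their number, until they
cover a part `A` of `M` and miss another part `B` (`exists_split`). Whatever is chosen in `B` is
then invisible to the thinned covers, and deleting a few neighbourhoods hides it from `A`. A vertex
of `B` becomes a branch vertex, with one private neighbour in each cover (`Cfg.insert_branch`).

Parity. A route between two branch vertices runs along an arm through one core, crosses `B`, and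
returns through a second core. If the two arms have opposite parity they meet in one vertex of `B`.
If they have equal parity they are joined by an edge of `B`, supplied by coherence; the only
possible chord then closes a triangle, which is the extra edge allowed in a fuzzy path
(`Cfg.exists_route`). Different routes use different covers, so even routes sharing a branch vertex
have anticomplete interiors, and the union is induced. -/

/-- The vertices with a neighbour in `Q`. -/
def nbhd {V : Type*} (G : SimpleGraph V) (Q : Set V) : Set V := {y | ∃ q ∈ Q, G.Adj q y}

/-- Any two vertices of `K` are joined by a walk inside `K`. -/
def Linked {V : Type*} (G : SimpleGraph V) (K : Set V) : Prop :=
  ∀ a ∈ K, ∀ b ∈ K, ∃ p : G.Walk a b, ∀ z ∈ p.support, z ∈ K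

/-- `M` is covered by `L`, all of whose vertices hang on a connected core `K` that does not
touch `M`. -/
structure IsCover {V : Type*} (G : SimpleGraph V) (K L M : Set V) : Prop where
  linked : Linked G K
  attach : ∀ q ∈ L, ∃ k ∈ K, G.Adj q k
  core : Anticomplete G K M
  disj : Disjoint L M
  cover : M ⊆ nbhd G L

/-! ### Mass estimates, balls, and the extraction of one cover -/

section Basic

variable {V : Type*} {G : SimpleGraph V} {μ : Set V → ℝ} {ε : ℝ}

theorem Anticomplete.mono {A B A' B' : Set V} (h : Anticomplete G A B) (hA : A' ⊆ A)
    (hB : B' ⊆ B) : Anticomplete G A' B' :=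
  ⟨h.1.mono hA hB, fun a ha b hb => h.2 a (hA ha) b (hB hb)⟩

theorem Anticomplete.symm {A B : Set V} (h : Anticomplete G A B) : Anticomplete G B A :=
  ⟨h.1.symm, fun a ha b hb hab => h.2 b hb a ha hab.symm⟩

theorem Anticomplete.union_left {A B C : Set V} (hA : Anticomplete G A C)
    (hB : Anticomplete G B C) : Anticomplete G (A ∪ B) C := by
  refine ⟨Set.disjoint_union_left.2 ⟨hA.1, hB.1⟩, ?_⟩
  rintro a (ha | ha) c hc
  exacts [hA.2 a ha c hc, hB.2 a ha c hc]

theorem Anticomplete.union_right {A B C : Set V} (hA : Anticomplete G C A)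
    (hB : Anticomplete G C B) : Anticomplete G C (A ∪ B) :=
  (hA.symm.union_left hB.symm).symm

theorem nbhd_union (Q Q' : Set V) : nbhd G (Q ∪ Q') = nbhd G Q ∪ nbhd G Q' := by
  ext y
  simp only [nbhd, Set.mem_union, Set.mem_ofPred_eq]
  grind

theorem nbhd_singleton (q : V) : nbhd G {q} = G.neighborSet q := by
  ext y; simp [nbhd]

namespace IsMass

theorem nonneg (h : IsMass μ) (X : Set V) : 0 ≤ μ X := h.empty ▸ h.mono _ _ (Set.empty_subset X)

theorem le_diff_add (h : IsMass μ) (X Y : Set V) : μ X ≤ μ (X \ Y) + μ (X ∩ Y) := by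
  conv_lhs => rw [← Set.sdiff_union_inter X Y]
  exact h.union_le _ _

theorem le_diff_add' (h : IsMass μ) (X Y : Set V) : μ X ≤ μ (X \ Y) + μ Y :=
  (h.le_diff_add X Y).trans (by gcongr; exact h.mono _ _ Set.inter_subset_right)

theorem nonempty_of_pos (h : IsMass μ) {X : Set V} (hX : 0 < μ X) : X.Nonempty := by
  rw [Set.nonempty_iff_ne_empty]
  rintro rfl
  exact hX.ne' h.empty

end IsMass

theorem IsCoherent.pos (hc : IsCoherent G μ ε) (hμ : IsMass μ) : 0 < ε := by
  obtain ⟨v, -⟩ := hμ.nonempty_of_pos (X := Set.univ) (by rw [hμ.univ]; norm_num)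
  exact (hμ.nonneg _).trans_lt (hc.singleton_lt v)

theorem IsCoherent.mass_nbhd_le (hc : IsCoherent G μ ε) (hμ : IsMass μ) (s : Finset V) :
    μ (nbhd G (s : Set V)) ≤ s.card * ε := by
  classical
  induction s using Finset.induction_on with
  | empty =>
    have : nbhd G (∅ : Set V) = ∅ := by ext; simp [nbhd]
    simp [this, hμ.empty]
  | insert a s ha ih =>
    have e : nbhd G ((insert a s : Finset V) : Set V) = G.neighborSet a ∪ nbhd G (s : Set V) := by
      rw [Finset.coe_insert, Set.insert_eq, nbhd_union, nbhd_singleton]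
    rw [e, Finset.card_insert_of_notMem ha]
    push_cast
    have := hμ.union_le (G.neighborSet a) (nbhd G (s : Set V))
    have := hc.neighborSet_lt a
    linarith

theorem IsCoherent.mass_diff_nbhd (hc : IsCoherent G μ ε) (hμ : IsMass μ) {A : Set V} {m : ℝ}
    {n : ℕ} (hA : m + n * ε ≤ μ A) (s : Finset V) (hs : s.card ≤ n) :
    m ≤ μ (A \ nbhd G (s : Set V)) := by
  have h1 := hμ.le_diff_add' A (nbhd G (s : Set V))
  have h2 := hc.mass_nbhd_le hμ s
  have h3 : (s.card : ℝ) * ε ≤ n * ε :=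
    mul_le_mul_of_nonneg_right (by exact_mod_cast hs) (hc.pos hμ).le
  linarith

theorem exists_minimal_subset [Finite V] (f : Set V → Prop) {L : Set V} (hL : f L) :
    ∃ Q ⊆ L, f Q ∧ ∀ q ∈ Q, ¬ f (Q \ {q}) := by
  obtain ⟨Q, hQL, hQ⟩ := exists_minimal_le_of_wellFoundedLT f L hL
  refine ⟨Q, hQL, hQ.prop, fun q hq h => ?_⟩
  have := hQ.le_of_le h Set.sdiff_subset hq
  exact this.2 rfl

/-- A part of `L` that is just large enough to cover mass `σ` in one of the given sets. -/
theorem exists_threshold_cover [Finite V] (hμ : IsMass μ) (hc : IsCoherent G μ ε) {ι : Type*}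
    (J : Finset ι) (M : ι → Set V) {σ : ℝ} (hσ : 0 < σ) {L : Set V}
    (hL : ∃ j ∈ J, σ ≤ μ (M j ∩ nbhd G L)) :
    ∃ Q ⊆ L, (∃ j ∈ J, σ ≤ μ (M j ∩ nbhd G Q)) ∧ ∀ l ∈ J, μ (M l) - σ - ε ≤ μ (M l \ nbhd G Q) := by
  obtain ⟨Q, hQL, hQ, hmin⟩ := exists_minimal_subset (fun Q => ∃ j ∈ J, σ ≤ μ (M j ∩ nbhd G Q)) hL
  refine ⟨Q, hQL, hQ, fun l hl => ?_⟩
  obtain ⟨j, -, hj⟩ := hQ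
  obtain ⟨y, -, q, hq, -⟩ := hμ.nonempty_of_pos (hσ.trans_le hj)
  -- `Q` is minimal for all indices at once, so deleting one `q` brings every `M l` below `σ`;
  -- restoring `q` adds less than `ε`.
  have h1 : μ (M l ∩ nbhd G (Q \ {q})) < σ := by
    by_contra! h
    exact hmin q hq ⟨l, hl, h⟩
  have h2 : M l ∩ nbhd G Q ⊆ (M l ∩ nbhd G (Q \ {q})) ∪ G.neighborSet q := by
    rintro y ⟨hy, p, hp, hpy⟩
    by_cases h : p = q
    · subst h; exact Or.inr hpy
    · exact Or.inl ⟨hy, p, ⟨hp, h⟩, hpy⟩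
  have h3 := (hμ.mono _ _ h2).trans (hμ.union_le _ _)
  have h4 := hc.neighborSet_lt q
  have h5 := hμ.le_diff_add (M l) (nbhd G Q)
  linarith

/-- A set of large mass contains a part of prescribed mass, up to `ε`. -/
theorem exists_subset_mass [Finite V] (hμ : IsMass μ) (hc : IsCoherent G μ ε) {Z : Set V} {s : ℝ}
    (hs : 0 < s) (hZ : s ≤ μ Z) : ∃ A ⊆ Z, s ≤ μ A ∧ μ Z - s - ε ≤ μ (Z \ A) := by
  obtain ⟨A, hA, hsA, hmin⟩ := exists_minimal_subset (fun A => s ≤ μ A) hZ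
  refine ⟨A, hA, hsA, ?_⟩
  obtain ⟨a, ha⟩ := hμ.nonempty_of_pos (hs.trans_le hsA)
  have h1 := hmin a ha
  have h2 := hc.singleton_lt a
  have h3 := hμ.le_diff_add' A {a}
  have h4 := hμ.le_diff_add' Z A
  linarith

/-- Cutting off one part of mass at least `m` costs at most `m + ε ≤ 2 * m`. -/
theorem exists_disjoint_family [Finite V] (hμ : IsMass μ) (hc : IsCoherent G μ ε) {m : ℝ}
    (hm : ε ≤ m) (n : ℕ) : ∀ Z : Set V, n * (2 * m) ≤ μ Z →
    ∃ M : Fin n → Set V, (∀ i, M i ⊆ Z) ∧ (∀ i, m ≤ μ (M i)) ∧ Pairwise fun i j => Disjoint (M i) (M j) := by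
  have hε := hc.pos hμ
  induction n with
  | zero => exact fun Z _ => ⟨fun _ => ∅, fun i => i.elim0, fun i => i.elim0, fun i => i.elim0⟩
  | succ n ih =>
    intro Z hZ
    push_cast at hZ
    have hn : 0 ≤ (n : ℝ) * (2 * m) := by have : 0 ≤ m := by linarith
                                          positivity
    obtain ⟨A, hAZ, hA, hZA⟩ := exists_subset_mass hμ hc (Z := Z) (s := m) (by linarith) (by linarith)
    obtain ⟨M, hM, hmass, hd⟩ := ih (Z \ A) (by linarith)
    refine ⟨Fin.cons A M, ?_, ?_, ?_⟩
    · intro i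
      refine Fin.cases hAZ (fun i => ?_) i
      exact (hM i).trans Set.sdiff_subset
    · intro i
      exact Fin.cases hA (fun i => hmass i) i
    · intro i j
      refine Fin.cases ?_ (fun i => ?_) i <;> refine Fin.cases ?_ (fun j => ?_) j
      · intro h; exact absurd rfl h
      · intro _
        exact (Set.disjoint_sdiff_left.mono_left (hM j)).symm
      · intro _
        exact Set.disjoint_sdiff_left.mono_left (hM i)
      · intro h
        exact hd fun e => h (congrArg Fin.succ e)

/-- The ball of radius `t` around `v` inside `Z`. -/
def ballIn (G : SimpleGraph V) (Z : Set V) (v : Z) (t : ℕ) : Set V :=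
  Subtype.val '' closedNhd (G.induce Z) t v

theorem ballIn_subset (Z : Set V) (v : Z) (t : ℕ) : ballIn G Z v t ⊆ Z := by
  rintro _ ⟨w, -, rfl⟩; exact w.2

theorem exists_walk_of_mem_closedNhd {t : ℕ} {v w : V} (h : w ∈ closedNhd G t v) :
    ∃ p : G.Walk v w, p.length ≤ t := by
  have h' : G.edist v w ≤ (t : ℕ∞) := h
  obtain ⟨p, hp⟩ := (SimpleGraph.reachable_of_edist_ne_top
    (ne_top_of_le_ne_top (ENat.natCast_ne_top t) h')).exists_walk_length_eq_edist
  exact ⟨p, by rw [← hp] at h'; exact_mod_cast h'⟩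

theorem linked_ballIn (Z : Set V) (v : Z) (t : ℕ) : Linked G (ballIn G Z v t) := by
  have key : ∀ a ∈ ballIn G Z v t, ∃ p : G.Walk v a, ∀ z ∈ p.support, z ∈ ballIn G Z v t := by
    rintro _ ⟨w, hw, rfl⟩
    obtain ⟨p, hp⟩ := exists_walk_of_mem_closedNhd hw
    refine ⟨p.map (SimpleGraph.Embedding.induce Z).toHom, fun z hz => ?_⟩
    have hz' : z ∈ p.support.map (SimpleGraph.Embedding.induce (G := G) Z).toHom := by
      rw [← SimpleGraph.Walk.support_map]; exact hz
    obtain ⟨y, hy, rfl⟩ := List.mem_map.1 hz'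
    refine ⟨y, ?_, rfl⟩
    classical
    simp only [closedNhd, Set.mem_ofPred_eq]
    refine (SimpleGraph.edist_le (p.takeUntil y hy)).trans ?_
    exact_mod_cast (p.length_takeUntil_le_length hy).trans hp
  intro a ha b hb
  obtain ⟨p, hp⟩ := key a ha
  obtain ⟨q, hq⟩ := key b hb
  refine ⟨p.reverse.append q, fun z hz => ?_⟩
  rw [SimpleGraph.Walk.mem_support_append_iff, SimpleGraph.Walk.support_reverse, List.mem_reverse] at hz
  exact hz.elim (hp z) (hq z)

theorem ballIn_zero (Z : Set V) (v : Z) : ballIn G Z v 0 = {(v : V)} := by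
  ext x
  simp only [ballIn, closedNhd, Set.mem_image, Set.mem_ofPred_eq, Nat.cast_zero, nonpos_iff_eq_zero,
    SimpleGraph.edist_eq_zero_iff, Set.mem_singleton_iff]
  constructor
  · rintro ⟨y, rfl, rfl⟩; rfl
  · rintro rfl; exact ⟨v, rfl, rfl⟩

theorem exists_adj_ballIn {Z : Set V} {v : Z} {t : ℕ} {q : V} (h : q ∈ ballIn G Z v (t + 1))
    (h' : q ∉ ballIn G Z v t) : ∃ k ∈ ballIn G Z v t, G.Adj q k := by
  obtain ⟨w, hw, rfl⟩ := h
  obtain ⟨p, hp⟩ := exists_walk_of_mem_closedNhd hw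
  have hn : ¬ p.Nil := by
    intro hn
    obtain rfl := hn.eq
    exact h' ⟨v, by simp [closedNhd], rfl⟩
  refine ⟨p.penultimate, ⟨p.penultimate, ?_, rfl⟩, ?_⟩
  · simp only [closedNhd, Set.mem_ofPred_eq]
    refine (SimpleGraph.edist_le p.dropLast).trans ?_
    have : p.dropLast.length ≤ t := by
      simp [SimpleGraph.Walk.dropLast]
      omega
    exact_mod_cast this
  · exact (p.adj_penultimate hn).symm

/-- In a massive set `Z`, a cover of a large part of one of several other massive sets can be
found, so that the other ones remain largely untouched. -/
theorem exists_core_and_leaves [Finite V] (hμ : IsMass μ) (hc : IsCoherent G μ ε) {δ : ℝ} {r : ℕ}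
    (hf : IsFocused G μ δ r) {m : ℝ} (hm : ε ≤ m) {Z : Set V} (hδ : δ ≤ μ Z) (hZ : 2 * ε ≤ μ Z)
    {ι : Type*} (J : Finset ι) (hJ : J.Nonempty) (M : ι → Set V) (hM : ∀ l ∈ J, (r + 3) * m ≤ μ (M l))
    (hd : ∀ l ∈ J, Disjoint Z (M l)) :
    ∃ K L : Set V, K ⊆ Z ∧ L ⊆ Z ∧ K.Nonempty ∧ Linked G K ∧ (∀ q ∈ L, ∃ k ∈ K, G.Adj q k) ∧
      (∃ j ∈ J, m ≤ μ ((M j \ nbhd G K) ∩ nbhd G L)) ∧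
      ∀ l ∈ J, m ≤ μ ((M l \ nbhd G K) \ nbhd G L) := by
  have hε := hc.pos hμ
  obtain ⟨v, hv⟩ := hf Z hδ
  change _ ≤ μ (ballIn G Z v r) at hv
  have hr : ∃ j ∈ J, (r + 1) * m ≤ μ (M j ∩ nbhd G (ballIn G Z v r)) := by
    obtain ⟨j, hj⟩ := hJ
    refine ⟨j, hj, ?_⟩
    have h1 := hc.anticomplete_lt (ballIn G Z v r) (M j \ nbhd G (ballIn G Z v r))
      ⟨(hd j hj).mono (ballIn_subset _ _ _) Set.sdiff_subset,
        fun a ha b hb hab => hb.2 ⟨a, ha, hab⟩⟩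
    have h2 := (min_lt_iff.1 h1).resolve_left (by linarith)
    have h3 := hμ.le_diff_add (M j) (nbhd G (ballIn G Z v r))
    have h4 := hM j hj
    linarith
  -- The threshold grows by `m` with the radius, so at the first radius that meets it the last shell
  -- alone accounts for more than `m` beyond what the previous ball reaches.
  have hex : ∃ t : ℕ, ∃ j ∈ J, (t + 1) * m ≤ μ (M j ∩ nbhd G (ballIn G Z v t)) := ⟨r, hr⟩
  classical
  obtain ⟨j, hj, hjt⟩ := Nat.find_spec hex
  have hmin := fun s => Nat.find_min (H := hex) (m := s)
  have htr : Nat.find hex ≤ r := Nat.find_min' hex hr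
  generalize Nat.find hex = t at *
  obtain _ | s := t
  -- Radius `0` is impossible: a single neighbourhood has mass below `ε ≤ m`.
  · rw [ballIn_zero, nbhd_singleton] at hjt
    have h1 := hμ.mono _ _ (Set.inter_subset_right (s := M j) (t := G.neighborSet v))
    have h2 := hc.neighborSet_lt (v : V)
    push_cast at hjt
    linarith
  have hs : ∀ l ∈ J, μ (M l ∩ nbhd G (ballIn G Z v s)) < (s + 1) * m := fun l hl => by
    by_contra! h
    exact hmin s (by omega) ⟨l, hl, h⟩
  push_cast at hjt
  obtain ⟨Q, hQ, hQ1, hQ2⟩ := exists_threshold_cover hμ hc J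
    (fun l => M l \ nbhd G (ballIn G Z v s)) (σ := m) (by linarith)
    (L := ballIn G Z v (s + 1) \ ballIn G Z v s) ⟨j, hj, by
      have h1 : M j ∩ nbhd G (ballIn G Z v (s + 1)) ⊆ (M j ∩ nbhd G (ballIn G Z v s)) ∪
          ((M j \ nbhd G (ballIn G Z v s)) ∩
            nbhd G (ballIn G Z v (s + 1) \ ballIn G Z v s)) := by
        rintro y ⟨hy, q, hq, hqy⟩
        by_cases h : y ∈ nbhd G (ballIn G Z v s)
        · exact Or.inl ⟨hy, h⟩
        · exact Or.inr ⟨⟨hy, h⟩, q, ⟨hq, fun h' => h ⟨q, h', hqy⟩⟩, hqy⟩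
      have h2 := (hμ.mono _ _ h1).trans (hμ.union_le _ _)
      have h3 := hs j hj
      linarith⟩
  refine ⟨ballIn G Z v s, Q, ballIn_subset _ _ _,
    fun q hq => ballIn_subset _ _ _ (hQ hq).1, ⟨v, v, by simp [closedNhd], rfl⟩,
    linked_ballIn _ _ _, fun q hq => exists_adj_ballIn (hQ hq).1 (hQ hq).2, hQ1, fun l hl => ?_⟩
  -- Losses in `M l`: less than `(s + 1) * m ≤ r * m` to the core and at most `m + ε ≤ 2 * m` to the
  -- leaves. With `m` to be kept, this explains `(r + 3) * m`.
  refine le_trans ?_ (hQ2 l hl)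
  have h1 := hμ.le_diff_add (M l) (nbhd G (ballIn G Z v s))
  have h2 := hs l hl
  have h3 := hM l hl
  have h4 : (s : ℝ) + 1 ≤ r := by exact_mod_cast htr
  have h5 : ((s : ℝ) + 1) * m ≤ r * m := mul_le_mul_of_nonneg_right h4 (by linarith)
  linarith

end Basic

/-! ### Accumulating many covers of one block -/

/-- Disjoint blocks `M i`, each with a finite set `D i` of covers, such that there are no
interactions between different blocks or between different covers. -/
structure CoverSystem {V ι : Type*} (G : SimpleGraph V) (J : Finset ι) (M : ι → Set V)
    (D : ι → Finset (Set V × Set V)) : Prop where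
  disjoint : ∀ i ∈ J, ∀ j ∈ J, i ≠ j → Disjoint (M i) (M j)
  cover : ∀ i ∈ J, ∀ c ∈ D i, IsCover G c.1 c.2 (M i)
  nonempty : ∀ i ∈ J, ∀ c ∈ D i, c.1.Nonempty
  covers_anti : ∀ i ∈ J, ∀ j ∈ J, ∀ c ∈ D i, ∀ d ∈ D j, i ≠ j ∨ c ≠ d →
    Anticomplete G (c.1 ∪ c.2) (d.1 ∪ d.2)
  cover_block_anti : ∀ i ∈ J, ∀ j ∈ J, i ≠ j → ∀ c ∈ D i, Anticomplete G (c.1 ∪ c.2) (M j)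

section CoverSystems

variable {V : Type*} {G : SimpleGraph V} {μ : Set V → ℝ} {ε : ℝ}

theorem IsCover.mono {K L M M' : Set V} (h : IsCover G K L M) (hM : M' ⊆ M) : IsCover G K L M' :=
  ⟨h.linked, h.attach, h.core.mono subset_rfl hM, h.disj.mono_right hM, hM.trans h.cover⟩

/-- Block `i` is sacrificed together with its own covers, and the new cover found inside it goes to
`j`. The other old covers do not touch block `i`, hence not the new cover either. Block `j` shrinks
to what the new leaves cover, the others to what they miss. -/
theorem CoverSystem.step [Finite V] (hμ : IsMass μ) (hc : IsCoherent G μ ε) {r : ℕ} {δ : ℝ}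
    (hf : IsFocused G μ δ r) {m : ℝ} (hm : ε ≤ m) (hδ : δ ≤ m) {ι : Type*} [DecidableEq ι]
    {J : Finset ι} {M : ι → Set V} {D : ι → Finset (Set V × Set V)} (S : CoverSystem G J M D)
    {i : ι} (hi : i ∈ J) (hJ : (J.erase i).Nonempty) (hM : ∀ l ∈ J, (r + 3) * m ≤ μ (M l)) :
    ∃ j ∈ J.erase i, ∃ (M' : ι → Set V) (D' : ι → Finset (Set V × Set V)),
      CoverSystem G (J.erase i) M' D' ∧ (∀ l ∈ J.erase i, m ≤ μ (M' l)) ∧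
      (D' j).card = (D j).card + 1 ∧ ∀ l, l ≠ j → D' l = D l := by
  classical
  have hε := hc.pos hμ
  have hm0 : 0 ≤ (r : ℝ) * m := mul_nonneg (Nat.cast_nonneg r) (by linarith)
  obtain ⟨K, L, hK, hL, hKne, hlink, hatt, ⟨j, hj, hjm⟩, hrest⟩ :=
    exists_core_and_leaves hμ hc hf hm (Z := M i) (by linarith [hM i hi]) (by linarith [hM i hi])
      (J.erase i) hJ M (fun l hl => hM l (Finset.mem_of_mem_erase hl))
      fun l hl => S.disjoint i hi l (Finset.mem_of_mem_erase hl) (Finset.ne_of_mem_erase hl).symm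
  have hKL : K ∪ L ⊆ M i := Set.union_subset hK hL
  have hJi : ∀ l ∈ J.erase i, l ∈ J ∧ i ≠ l := fun l hl =>
    ⟨Finset.mem_of_mem_erase hl, (Finset.ne_of_mem_erase hl).symm⟩
  have hold : ∀ l ∈ J.erase i, ∀ c ∈ D l, Anticomplete G (c.1 ∪ c.2) (K ∪ L) := fun l hl c hcl =>
    (S.cover_block_anti l (hJi l hl).1 i hi (hJi l hl).2.symm c hcl).mono subset_rfl hKL
  have hnotmem : (K, L) ∉ D j := fun h => by
    obtain ⟨k, hk⟩ := hKne
    exact Set.disjoint_left.1 (hold j hj _ h).1 (Or.inl hk) (Or.inl hk)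
  set M' : ι → Set V := fun l =>
    if l = j then (M l \ nbhd G K) ∩ nbhd G L else (M l \ nbhd G K) \ nbhd G L with hM'
  set D' : ι → Finset (Set V × Set V) := fun l => if l = j then insert (K, L) (D l) else D l with hD'
  have hsub : ∀ l, M' l ⊆ M l \ nbhd G K := fun l => by
    simp only [hM']; split_ifs
    exacts [Set.inter_subset_left, Set.sdiff_subset]
  have hsub' : ∀ l, M' l ⊆ M l := fun l => (hsub l).trans Set.sdiff_subset
  have hmem : ∀ l c, c ∈ D' l → c ∈ D l ∨ (l = j ∧ c = (K, L)) := fun l c h => by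
    simp only [hD'] at h; split_ifs at h with e
    · rcases Finset.mem_insert.1 h with rfl | h
      exacts [Or.inr ⟨e, rfl⟩, Or.inl h]
    · exact Or.inl h
  have hKanti : ∀ l ∈ J.erase i, Anticomplete G K (M' l) := fun l hl =>
    ⟨(S.disjoint i hi l (hJi l hl).1 (hJi l hl).2).mono hK (hsub' l),
      fun a ha b hb hab => (hsub l hb).2 ⟨a, ha, hab⟩⟩
  refine ⟨j, hj, M', D', ⟨?_, ?_, ?_, ?_, ?_⟩, ?_, ?_, ?_⟩
  · exact fun a ha b hb hab =>
      (S.disjoint a (hJi a ha).1 b (hJi b hb).1 hab).mono (hsub' a) (hsub' b)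
  · intro l hl c hcl
    rcases hmem l c hcl with h | ⟨rfl, rfl⟩
    · exact (S.cover l (hJi l hl).1 c h).mono (hsub' l)
    · refine ⟨hlink, hatt, hKanti l hl, (S.disjoint i hi l (hJi l hl).1 (hJi l hl).2).mono hL (hsub' l), ?_⟩
      simp only [hM', if_true]
      exact Set.inter_subset_right
  · intro l hl c hcl
    rcases hmem l c hcl with h | ⟨rfl, rfl⟩
    · exact S.nonempty l (hJi l hl).1 c h
    · exact hKne
  · intro a ha b hb c hca d hdb hne
    rcases hmem a c hca with h | ⟨rfl, rfl⟩ <;> rcases hmem b d hdb with h' | ⟨h', rfl⟩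
    · exact S.covers_anti a (hJi a ha).1 b (hJi b hb).1 c h d h' hne
    · exact hold a ha c h
    · exact (hold b hb d h').symm
    · subst h'; simp at hne
  · intro a ha b hb hab c hca
    rcases hmem a c hca with h | ⟨rfl, rfl⟩
    · exact (S.cover_block_anti a (hJi a ha).1 b (hJi b hb).1 hab c h).mono subset_rfl (hsub' b)
    · refine (hKanti b hb).union_left
        ⟨(S.disjoint i hi b (hJi b hb).1 (hJi b hb).2).mono hL (hsub' b), ?_⟩
      intro q hq y hy hqy
      simp only [hM', if_neg hab.symm] at hy
      exact hy.2 ⟨q, hq, hqy⟩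
  · intro l hl
    simp only [hM']; split_ifs with e
    · rw [e]; exact hjm
    · exact hrest l hl
  · simp only [hD', if_true]
    exact Finset.card_insert_of_notMem hnotmem
  · intro l hl
    simp only [hD', if_neg hl]

/-- The potential is the sum of `2 ^ (D l).card`. Sacrificing a block with fewest covers loses `2 ^
(D i).card`, while the extra cover at `j` gains `2 ^ (D j).card`, which is no smaller. Each of the
`n` rounds costs a factor `r + 3` in mass. -/
theorem CoverSystem.exists_single [Finite V] (hμ : IsMass μ) (hc : IsCoherent G μ ε) {r : ℕ} {δ : ℝ}
    (hf : IsFocused G μ δ r) {m : ℝ} (hm : ε ≤ m) (hδ : δ ≤ m) {ι : Type*} [DecidableEq ι] (n : ℕ) :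
    ∀ (J : Finset ι) (M : ι → Set V) (D : ι → Finset (Set V × Set V)), CoverSystem G J M D →
      J.card = n + 1 → (∀ l ∈ J, (r + 3) ^ n * m ≤ μ (M l)) →
      ∃ (i : ι) (M' : ι → Set V) (D' : ι → Finset (Set V × Set V)), CoverSystem G {i} M' D' ∧
        m ≤ μ (M' i) ∧ ∑ l ∈ J, 2 ^ (D l).card ≤ 2 ^ (D' i).card := by
  have hε := hc.pos hμ
  induction n with
  | zero =>
    intro J M D S hJ hM
    obtain ⟨i, rfl⟩ := Finset.card_eq_one.1 hJ
    exact ⟨i, M, D, S, by simpa using hM i, by simp⟩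
  | succ n ih =>
    intro J M D S hJ hM
    have hJne : J.Nonempty := Finset.card_pos.1 (by omega)
    obtain ⟨i, hi, hmin⟩ := J.exists_min_image (fun l => (D l).card) hJne
    have hcard : (J.erase i).card = n + 1 := by rw [Finset.card_erase_of_mem hi, hJ]; rfl
    have h1 : (1 : ℝ) ≤ (r + 3) ^ n := one_le_pow₀ (by linarith [(Nat.cast_nonneg r : (0 : ℝ) ≤ r)])
    have h2 : m ≤ (r + 3) ^ n * m := le_mul_of_one_le_left (by linarith) h1
    obtain ⟨j, hj, M', D', S', hM', hDj, hDl⟩ := S.step hμ hc hf (hm.trans h2) (hδ.trans h2) hi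
      (Finset.card_pos.1 (by omega)) (fun l hl => by
        have := hM l hl
        rwa [pow_succ', mul_assoc] at this)
    obtain ⟨a, M'', D'', S'', hM'', hsum⟩ := ih (J.erase i) M' D' S' hcard hM'
    refine ⟨a, M'', D'', S'', hM'', le_trans ?_ hsum⟩
    rw [← Finset.add_sum_erase J _ hi, ← Finset.add_sum_erase _ _ hj, ← Finset.add_sum_erase _ _ hj,
      hDj, pow_succ, Finset.sum_congr rfl fun l hl => by rw [← hDl l (Finset.ne_of_mem_erase hl)]]
    have := Nat.pow_le_pow_right two_pos (hmin j (Finset.mem_of_mem_erase hj))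
    omega

/-- Many pairwise anticomplete covers of the same massive set. -/
theorem exists_common_covers [Finite V] (hμ : IsMass μ) (hc : IsCoherent G μ ε) {r : ℕ} {δ : ℝ}
    (hf : IsFocused G μ δ r) {m : ℝ} (hm : ε ≤ m) (hδ : δ ≤ m) (k : ℕ)
    (hmk : 2 ^ k * (2 * ((r + 3) ^ (2 ^ k) * m)) ≤ 1) :
    ∃ (M : Set V) (D : Finset (Set V × Set V)), m ≤ μ M ∧ D.card = k ∧
      (∀ c ∈ D, IsCover G c.1 c.2 M) ∧
      ∀ c ∈ D, ∀ d ∈ D, c ≠ d → Anticomplete G (c.1 ∪ c.2) (d.1 ∪ d.2) := by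
  have hε := hc.pos hμ
  have h1 : (1 : ℝ) ≤ (r + 3) ^ (2 ^ k) :=
    one_le_pow₀ (by linarith [(Nat.cast_nonneg r : (0 : ℝ) ≤ r)])
  have h2 : m ≤ (r + 3) ^ (2 ^ k) * m := le_mul_of_one_le_left (by linarith) h1
  obtain ⟨M, -, hM, hd⟩ := exists_disjoint_family hμ hc (hm.trans h2) (2 ^ k) Set.univ
    (by rw [hμ.univ]; exact_mod_cast hmk)
  obtain ⟨n, hn⟩ : ∃ n, 2 ^ k = n + 1 := ⟨2 ^ k - 1, (Nat.sub_add_cancel Nat.one_le_two_pow).symm⟩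
  obtain ⟨i, M', D', S, hm', hsum⟩ := CoverSystem.exists_single hμ hc hf hm hδ n
    (Finset.univ : Finset (Fin (2 ^ k))) M (fun _ => ∅) ⟨fun i _ j _ hij => hd hij, by simp, by simp,
      by simp, by simp⟩ (by simpa using hn) (fun l _ => le_trans (by
        gcongr
        · linarith
        · linarith [(Nat.cast_nonneg r : (0 : ℝ) ≤ r)]
        · omega) (hM l))
  -- The `2 ^ k` initial blocks have no covers, so the potential starts at `2 ^ k`.
  have hk : k ≤ (D' i).card := by
    simpa [Nat.pow_le_pow_iff_right] using hsum
  obtain ⟨D, hD, hDk⟩ := Finset.exists_subset_card_eq hk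
  exact ⟨M' i, D, hm', hDk, fun c h => S.cover i (by simp) c (hD h), fun c h d h' hne =>
    S.covers_anti i (by simp) i (by simp) c (hD h) d (hD h') (Or.inr hne)⟩

end CoverSystems

/-! ### Thinning covers so that they miss a massive set -/

section Split

variable {V ι : Type*} {G : SimpleGraph V} {μ : Set V → ℝ} {ε : ℝ}

/-- Each covering set is cut to a threshold part `Q` that reaches mass `σ` on one side. That side is
restricted to the neighbours of `Q`, the other to the non-neighbours, whose mass is at least `3 * σ
- σ - ε ≥ σ`: hence one factor 3 per set. `S` records the sets directed at `A`. -/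
theorem exists_directed_split [Finite V] (hμ : IsMass μ) (hc : IsCoherent G μ ε) {b : ℝ} (hb : ε ≤ b)
    (P : ι → Set V) (C : Finset ι) : ∀ A B : Set V, 3 ^ C.card * b ≤ μ A → 3 ^ C.card * b ≤ μ B →
    (∀ c ∈ C, A ⊆ nbhd G (P c) ∧ B ⊆ nbhd G (P c)) →
    ∃ A' ⊆ A, ∃ B' ⊆ B, ∃ (P' : ι → Set V) (S : Set ι), b ≤ μ A' ∧ b ≤ μ B' ∧ ∀ c ∈ C, P' c ⊆ P c ∧
      (c ∈ S → A' ⊆ nbhd G (P' c) ∧ Disjoint B' (nbhd G (P' c))) ∧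
      (c ∉ S → B' ⊆ nbhd G (P' c) ∧ Disjoint A' (nbhd G (P' c))) := by
  classical
  have hε := hc.pos hμ
  induction C using Finset.induction_on with
  | empty => exact fun A B hA hB _ => ⟨A, subset_rfl, B, subset_rfl, P, ∅, by simpa using hA,
      by simpa using hB, by simp⟩
  | insert c C hcC ih =>
    intro A B hA hB hP
    rw [Finset.card_insert_of_notMem hcC, pow_succ'] at hA hB
    have h1 : b ≤ 3 ^ C.card * b := le_mul_of_one_le_left (by linarith) (one_le_pow₀ (by norm_num))
    set σ := 3 ^ C.card * b with hσ
    obtain ⟨Q, hQ, ⟨j, -, hj⟩, hrest⟩ := exists_threshold_cover hμ hc (Finset.univ : Finset Bool)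
      (fun i => if i then A else B) (σ := σ) (by linarith) (L := P c) ⟨true, by simp, by
        have := (hP c (by simp)).1
        simp only [if_true, Set.inter_eq_left.2 this]
        nlinarith⟩
    have hPC : ∀ d ∈ C, A ⊆ nbhd G (P d) ∧ B ⊆ nbhd G (P d) := fun d hd =>
      hP d (Finset.mem_insert_of_mem hd)
    have hAr := hrest true (by simp)
    have hBr := hrest false (by simp)
    simp only [if_true, Bool.false_eq_true, if_false] at hAr hBr
    cases j with
    | true =>
      simp only [if_true] at hj
      obtain ⟨A', hA', B', hB', P', S, hmA, hmB, hS⟩ := ih (A ∩ nbhd G Q) (B \ nbhd G Q) hj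
        (by linarith) fun d hd => ⟨Set.inter_subset_left.trans (hPC d hd).1,
          Set.sdiff_subset.trans (hPC d hd).2⟩
      refine ⟨A', hA'.trans Set.inter_subset_left, B', hB'.trans Set.sdiff_subset,
        Function.update P' c Q, insert c S, hmA, hmB, fun d hd => ?_⟩
      by_cases hdc : d = c
      · subst hdc
        simp only [Function.update_self, Set.mem_insert_iff, true_or, not_true_eq_false,
          true_imp_iff, false_imp_iff, and_true]
        exact ⟨hQ, hA'.trans Set.inter_subset_right, Set.disjoint_sdiff_left.mono_left hB'⟩
      · simpa [Function.update_of_ne hdc, hdc] using hS d (Finset.mem_of_mem_insert_of_ne hd hdc)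
    | false =>
      simp only [Bool.false_eq_true, if_false] at hj
      obtain ⟨A', hA', B', hB', P', S, hmA, hmB, hS⟩ := ih (A \ nbhd G Q) (B ∩ nbhd G Q)
        (by linarith) hj fun d hd => ⟨Set.sdiff_subset.trans (hPC d hd).1,
          Set.inter_subset_left.trans (hPC d hd).2⟩
      -- Nothing is known about `S` outside `C`, so `c` has to be removed explicitly.
      refine ⟨A', hA'.trans Set.sdiff_subset, B', hB'.trans Set.inter_subset_left,
        Function.update P' c Q, S \ {c}, hmA, hmB, fun d hd => ?_⟩
      by_cases hdc : d = c
      · subst hdc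
        simp only [Function.update_self, Set.mem_sdiff, Set.mem_singleton_iff, not_true_eq_false,
          and_false, not_false_eq_true, true_imp_iff, false_imp_iff, true_and]
        exact ⟨hQ, hB'.trans Set.inter_subset_right, Set.disjoint_sdiff_left.mono_left hA'⟩
      · simpa [Function.update_of_ne hdc, hdc] using hS d (Finset.mem_of_mem_insert_of_ne hd hdc)

/-- Given `2 * N` sets covering `M`, find disjoint massive parts `A`, `B` of `M`, and parts of `N`
of the covering sets that cover `A` and do not touch `B`. -/
theorem exists_split [Finite V] (hμ : IsMass μ) (hc : IsCoherent G μ ε) {b : ℝ} (hb : ε ≤ b)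
    {N : ℕ} (P : ι → Set V) {C : Finset ι} (hC : C.card = 2 * N) {M : Set V}
    (hM : 3 ^ (2 * N + 1) * b ≤ μ M) (hP : ∀ c ∈ C, M ⊆ nbhd G (P c)) :
    ∃ A ⊆ M, ∃ B ⊆ M, Disjoint A B ∧ b ≤ μ A ∧ b ≤ μ B ∧ ∃ C' ⊆ C, C'.card = N ∧ ∃ P' : ι → Set V,
      ∀ c ∈ C', P' c ⊆ P c ∧ A ⊆ nbhd G (P' c) ∧ Disjoint B (nbhd G (P' c)) := by
  classical
  have hε := hc.pos hμ
  have h1 : b ≤ 3 ^ (2 * N) * b := le_mul_of_one_le_left (by linarith) (one_le_pow₀ (by norm_num))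
  rw [pow_succ', mul_assoc] at hM
  obtain ⟨A₀, hA₀, hmA₀, hmB₀⟩ := exists_subset_mass hμ hc (Z := M) (s := 3 ^ (2 * N) * b)
    (by linarith) (by linarith)
  obtain ⟨A, hA, B, hB, P', S, hmA, hmB, hS⟩ := exists_directed_split hμ hc hb P C A₀ (M \ A₀)
    (by rwa [hC]) (by rw [hC]; linarith) fun c h => ⟨hA₀.trans (hP c h), Set.sdiff_subset.trans (hP c h)⟩
  have hd : Disjoint A B := Set.disjoint_sdiff_right.mono hA hB
  have hcard := Finset.card_filter_add_card_filter_not (s := C) (fun c => c ∈ S)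
  by_cases h : N ≤ (C.filter fun c => c ∈ S).card
  · obtain ⟨C', hC', hcard'⟩ := Finset.exists_subset_card_eq h
    refine ⟨A, hA.trans hA₀, B, hB.trans Set.sdiff_subset, hd, hmA, hmB, C',
      hC'.trans (Finset.filter_subset _ _), hcard', P', fun c hcC => ?_⟩
    obtain ⟨h1, h2⟩ := Finset.mem_filter.1 (hC' hcC)
    exact ⟨(hS c h1).1, (hS c h1).2.1 h2⟩
  · obtain ⟨C', hC', hcard'⟩ := Finset.exists_subset_card_eq
      (show N ≤ (C.filter fun c => ¬ c ∈ S).card by omega)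
    refine ⟨B, hB.trans Set.sdiff_subset, A, hA.trans hA₀, hd.symm, hmB, hmA, C',
      hC'.trans (Finset.filter_subset _ _), hcard', P', fun c hcC => ?_⟩
    obtain ⟨h1, h2⟩ := Finset.mem_filter.1 (hC' hcC)
    exact ⟨(hS c h1).1, (hS c h1).2.2 h2⟩

end Split

/-! ### Configurations: planting the branch vertices -/

/-- The part of the graph belonging to the cover with index `c`. -/
def hub {V W ι : Type*} (K : ι → Set V) (p : ι → W → V) (P : ι → Set V) (D : Finset W) (c : ι) :
    Set V :=
  K c ∪ P c ∪ p c '' D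

/-- Vertices `x w`, for `w ∈ D`, and pairwise anticomplete covers of `M` away from these vertices,
with private connections `p c w` between the core of the cover `c` and `x w`. -/
structure Cfg {V W ι : Type*} (G : SimpleGraph V) (D : Finset W) (x : W → V) (K : ι → Set V)
    (p : ι → W → V) (C : Finset ι) (P : ι → Set V) (M : Set V) : Prop where
  cover : ∀ c ∈ C, IsCover G (K c) (P c) M
  p_attach : ∀ c ∈ C, ∀ w ∈ D, ∃ k ∈ K c, G.Adj (p c w) k
  sep : ∀ c ∈ C, ∀ d ∈ C, c ≠ d → Anticomplete G (hub K p P D c) (hub K p P D d)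
  stable : ∀ w ∈ D, ∀ w' ∈ D, ¬ G.Adj (x w) (x w')
  inj : ∀ w ∈ D, ∀ w' ∈ D, x w = x w' → w = w'
  x_anti : ∀ w ∈ D, Anticomplete G {x w} M
  x_hub_anti : ∀ c ∈ C, ∀ w ∈ D, Anticomplete G {x w} (K c ∪ P c)
  p_adj : ∀ c ∈ C, ∀ w ∈ D, G.Adj (p c w) (x w)
  p_not_adj : ∀ c ∈ C, ∀ w ∈ D, ∀ w' ∈ D, w ≠ w' → ¬ G.Adj (p c w) (x w')
  p_anti : ∀ c ∈ C, ∀ w ∈ D, Anticomplete G {p c w} M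

section Configurations

variable {V W ι : Type*} {G : SimpleGraph V} {μ : Set V → ℝ} {ε : ℝ}

theorem Cfg.mono {D : Finset W} {x : W → V} {K : ι → Set V} {p : ι → W → V} {C C' : Finset ι}
    {P P' : ι → Set V} {M M' : Set V} (h : Cfg G D x K p C P M) (hC : C' ⊆ C) (hM : M' ⊆ M)
    (hP : ∀ c ∈ C', P' c ⊆ P c ∧ M' ⊆ nbhd G (P' c)) : Cfg G D x K p C' P' M' := by
  have hhub : ∀ c ∈ C', hub K p P' D c ⊆ hub K p P D c := fun c hc =>
    Set.union_subset_union_left _ (Set.union_subset_union_right _ (hP c hc).1)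
  constructor
  · intro c hc
    have H := h.cover c (hC hc)
    exact ⟨H.linked, fun q hq => H.attach q ((hP c hc).1 hq), H.core.mono subset_rfl hM,
      H.disj.mono (hP c hc).1 hM, (hP c hc).2⟩
  · exact fun c hc => h.p_attach c (hC hc)
  · exact fun c hc d hd hne => (h.sep c (hC hc) d (hC hd) hne).mono (hhub c hc) (hhub d hd)
  · exact h.stable
  · exact h.inj
  · exact fun w hw => (h.x_anti w hw).mono subset_rfl hM
  · exact fun c hc w hw => (h.x_hub_anti c (hC hc) w hw).mono subset_rfl
      (Set.union_subset_union_right _ (hP c hc).1)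
  · exact fun c hc => h.p_adj c (hC hc)
  · exact fun c hc => h.p_not_adj c (hC hc)
  · exact fun c hc w hw => (h.p_anti c (hC hc) w hw).mono subset_rfl hM

/-- The new branch vertex `z` is any vertex of `B`: the thinned covers miss it, while each original
cover has a leaf `q c` next to it, which serves as the private connection. As `q c` already lies in
the hub of `c`, separation of the hubs is inherited. -/
theorem Cfg.insert_branch [Finite V] [DecidableEq W] (hμ : IsMass μ) (hc : IsCoherent G μ ε)
    {D : Finset W} {x : W → V} {K : ι → Set V} {p : ι → W → V} {C : Finset ι} {P : ι → Set V}
    {M : Set V} (h : Cfg G D x K p C P M) {N m : ℕ} (hC : C.card = 2 * N)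
    (hM : (3 ^ (2 * N + 1) * (m + N + 1) : ℕ) * ε ≤ μ M) {w : W} (hw : w ∉ D) :
    ∃ (x' : W → V) (p' : ι → W → V) (C' : Finset ι) (P' : ι → Set V) (M' : Set V),
      Cfg G (insert w D) x' K p' C' P' M' ∧ C'.card = N ∧ m * ε ≤ μ M' := by
  classical
  have hε := hc.pos hμ
  have hm0 : (0 : ℝ) ≤ m * ε := by positivity
  have hN0 : (0 : ℝ) ≤ N * ε := by positivity
  obtain ⟨A, hA, B, hB, hAB, hmA, hmB, C', hC', hcard, P', hP'⟩ := exists_split hμ hc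
    (b := (m + N + 1) * ε) (by linarith) P hC (M := M) (by push_cast at hM; linarith)
    fun c hc => (h.cover c hc).cover
  obtain ⟨z, hz⟩ := hμ.nonempty_of_pos (X := B) (by linarith)
  -- The leaf comes from `P c`, not from `P' c`, which has no neighbour of `z`. Outside `C'` the
  -- value is a dummy.
  have hq : ∀ c, ∃ q, c ∈ C' → q ∈ P c ∧ G.Adj q z := fun c => by
    by_cases hcC : c ∈ C'
    · obtain ⟨q, hq⟩ := (h.cover c (hC' hcC)).cover (hB hz)
      exact ⟨q, fun _ => hq⟩
    · exact ⟨z, fun h => absurd h hcC⟩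
  choose q hq using hq
  set s : Finset V := insert z (C'.image q) with hs
  -- The neighbourhoods of `z` and of `N` leaves are deleted, which costs `(N + 1) * ε`.
  have hA' := hc.mass_diff_nbhd hμ (A := A) (m := m * ε) (n := N + 1) (by push_cast; linarith) s
    ((Finset.card_insert_le _ _).trans (by
      have := Finset.card_image_le (s := C') (f := q)
      omega))
  have hzA : ∀ a ∈ A \ nbhd G (s : Set V), ¬ G.Adj z a := fun a ha hadj =>
    ha.2 ⟨z, by simp [hs], hadj⟩
  have hqA : ∀ c ∈ C', ∀ a ∈ A \ nbhd G (s : Set V), ¬ G.Adj (q c) a := fun c hcC a ha hadj =>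
    ha.2 ⟨q c, by simp only [hs, Finset.coe_insert, Finset.coe_image]; exact Or.inr ⟨c, hcC, rfl⟩, hadj⟩
  have H := h.mono (P' := P') hC' (M' := A \ nbhd G (s : Set V)) (Set.sdiff_subset.trans hA)
    fun c hcC => ⟨(hP' c hcC).1, Set.sdiff_subset.trans (hP' c hcC).2.1⟩
  have hne : ∀ v ∈ D, v ≠ w := fun v hv e => hw (e ▸ hv)
  have hx : ∀ v ∈ D, Function.update x w z v = x v := fun v hv => Function.update_of_ne (hne v hv) _ _
  have hp : ∀ c, ∀ v ∈ D, Function.update (p c) w (q c) v = p c v := fun c v hv =>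
    Function.update_of_ne (hne v hv) _ _
  have hxz : ∀ v ∈ D, ¬ G.Adj (x v) z := fun v hv => (h.x_anti v hv).2 _ rfl z (hB hz)
  have hsub : ∀ c ∈ C', hub K (fun c => Function.update (p c) w (q c)) P' (insert w D) c ⊆
      hub K p P D c := by
    rintro c hcC a ((ha | ha) | ⟨v, hv, rfl⟩)
    · exact Or.inl (Or.inl ha)
    · exact Or.inl (Or.inr ((hP' c hcC).1 ha))
    · rcases Finset.mem_insert.1 hv with rfl | hv
      · simp only [Function.update_self]
        exact Or.inl (Or.inr (hq c hcC).1)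
      · simp only [hp c v hv]
        exact Or.inr ⟨v, hv, rfl⟩
  refine ⟨Function.update x w z, fun c => Function.update (p c) w (q c), C', P',
    A \ nbhd G (s : Set V), ⟨H.cover, ?_, ?_, ?_, ?_, ?_, ?_, ?_, ?_, ?_⟩, hcard, hA'⟩
  · intro c hcC v hv
    rcases Finset.mem_insert.1 hv with rfl | hv
    · simp only [Function.update_self]
      exact (h.cover c (hC' hcC)).attach _ (hq c hcC).1
    · simp only [hp c v hv]
      exact H.p_attach c hcC v hv
  · exact fun c hcC d hd hne => (h.sep c (hC' hcC) d (hC' hd) hne).mono (hsub c hcC) (hsub d hd)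
  · intro v hv₀ v' hv₀'
    rcases Finset.mem_insert.1 hv₀ with rfl | hv <;> rcases Finset.mem_insert.1 hv₀' with rfl | hv'
    · exact G.loopless.irrefl _
    · rw [Function.update_self, hx v' hv']
      exact fun e => hxz v' hv' e.symm
    · rw [Function.update_self, hx v hv]
      exact hxz v hv
    · rw [hx v hv, hx v' hv']
      exact h.stable v hv v' hv'
  · have hxne : ∀ v ∈ D, x v ≠ z := fun v hv e =>
      Set.disjoint_left.1 (h.x_anti v hv).1 rfl (e ▸ hB hz)
    intro v hv₀ v' hv₀' e
    rcases Finset.mem_insert.1 hv₀ with rfl | hv <;> rcases Finset.mem_insert.1 hv₀' with rfl | hv'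
    · rfl
    · rw [Function.update_self, hx v' hv'] at e
      exact absurd e.symm (hxne v' hv')
    · rw [Function.update_self, hx v hv] at e
      exact absurd e (hxne v hv)
    · rw [hx v hv, hx v' hv'] at e
      exact h.inj v hv v' hv' e
  · intro v hv
    rcases Finset.mem_insert.1 hv with rfl | hv
    · rw [Function.update_self]
      refine ⟨Set.disjoint_singleton_left.2 fun h => Set.disjoint_left.1 hAB h.1 hz, ?_⟩
      rintro _ rfl a ha
      exact hzA a ha
    · rw [hx v hv]; exact H.x_anti v hv
  · intro c hcC v hv
    rcases Finset.mem_insert.1 hv with rfl | hv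
    · rw [Function.update_self]
      refine Anticomplete.union_right
        ((h.cover c (hC' hcC)).core.symm.mono (Set.singleton_subset_iff.2 (hB hz)) subset_rfl)
        ⟨((h.cover c (hC' hcC)).disj.symm.mono (Set.singleton_subset_iff.2 (hB hz)) (hP' c hcC).1), ?_⟩
      rintro _ rfl a ha hadj
      exact Set.disjoint_left.1 (hP' c hcC).2.2 hz ⟨a, ha, hadj.symm⟩
    · rw [hx v hv]; exact H.x_hub_anti c hcC v hv
  · intro c hcC v hv
    rcases Finset.mem_insert.1 hv with rfl | hv
    · simp only [Function.update_self]
      exact (hq c hcC).2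
    · simp only [hp c v hv, hx v hv]
      exact H.p_adj c hcC v hv
  · intro c hcC v hv₀ v' hv₀' hvv
    rcases Finset.mem_insert.1 hv₀ with rfl | hv <;> rcases Finset.mem_insert.1 hv₀' with rfl | hv'
    · exact absurd rfl hvv
    · simp only [Function.update_self, hx v' hv']
      exact fun e => (h.x_hub_anti c (hC' hcC) v' hv').2 _ rfl _ (Or.inr (hq c hcC).1) e.symm
    · simp only [Function.update_self, hp c v hv]
      exact (h.p_anti c (hC' hcC) v hv).2 _ rfl z (hB hz)
    · simp only [hp c v hv, hx v' hv']
      exact H.p_not_adj c hcC v hv v' hv' hvv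
  · intro c hcC v hv
    rcases Finset.mem_insert.1 hv with rfl | hv
    · simp only [Function.update_self]
      refine ⟨(h.cover c (hC' hcC)).disj.mono (Set.singleton_subset_iff.2 (hq c hcC).1)
        (Set.sdiff_subset.trans hA), ?_⟩
      rintro _ rfl a ha
      exact hqA c hcC a ha
    · simp only [hp c v hv]; exact H.p_anti c hcC v hv

end Configurations

/-- From sufficiently many covers of a sufficiently massive set, all branch vertices can be
found. -/
theorem exists_cfg.{u, v, w} {W : Type v} (D : Finset W) : ∀ N m : ℕ, ∃ N₀ m₀ : ℕ,
    ∀ (V : Type u) [Finite V] (ι : Type w) (G : SimpleGraph V) (μ : Set V → ℝ) (ε : ℝ), IsMass μ →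
    IsCoherent G μ ε → ∀ (C : Finset ι) (K P : ι → Set V) (M : Set V), C.card = N₀ →
    (∀ c ∈ C, IsCover G (K c) (P c) M) →
    (∀ c ∈ C, ∀ d ∈ C, c ≠ d → Anticomplete G (K c ∪ P c) (K d ∪ P d)) → m₀ * ε ≤ μ M →
    ∃ (x : W → V) (p : ι → W → V) (C' : Finset ι) (P' : ι → Set V) (M' : Set V),
      Cfg G D x K p C' P' M' ∧ C'.card = N ∧ m * ε ≤ μ M' := by
  classical
  induction D using Finset.induction_on with
  | empty =>
    refine fun N m => ⟨N, m, fun V _ ι G μ ε hμ hc C K P M hC hcov hsep hM => ?_⟩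
    obtain ⟨v, -⟩ := hμ.nonempty_of_pos (X := Set.univ) (by rw [hμ.univ]; norm_num)
    exact ⟨fun _ => v, fun _ _ => v, C, P, M, ⟨hcov, by simp, by simpa [hub] using hsep, by simp,
      by simp, by simp, by simp, by simp, by simp, by simp⟩, hC, hM⟩
  | insert w D hw ih =>
    intro N m
    obtain ⟨N₀, m₀, H⟩ := ih (2 * N) (3 ^ (2 * N + 1) * (m + N + 1))
    refine ⟨N₀, m₀, fun V _ ι G μ ε hμ hc C K P M hC hcov hsep hM => ?_⟩
    obtain ⟨x, p, C', P', M', hcfg, hC', hM'⟩ := H V ι G μ ε hμ hc C K P M hC hcov hsep hM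
    exact hcfg.insert_branch hμ hc hC' hM' hw

/-! ### Induced paths with controlled chords, and routes -/

/-- A path all of whose chords belong to `X`. -/
def NearInduced {V : Type*} {G : SimpleGraph V} {s t : V} (p : G.Walk s t) (X : Set (Sym2 V)) :
    Prop :=
  p.IsPath ∧ ∀ a ∈ p.support, ∀ b ∈ p.support, G.Adj a b → s(a, b) ∈ p.edges ∨ s(a, b) ∈ X

section Paths

variable {V : Type*} {G : SimpleGraph V}

theorem nearInduced_nil (v : V) (X : Set (Sym2 V)) : NearInduced (SimpleGraph.Walk.nil : G.Walk v v) X := by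
  refine ⟨SimpleGraph.Walk.IsPath.nil, ?_⟩
  simp only [SimpleGraph.Walk.support_nil, List.mem_singleton]
  rintro a rfl b rfl h
  exact absurd h (G.loopless.irrefl _)

theorem NearInduced.mono {s t : V} {p : G.Walk s t} {X Y : Set (Sym2 V)} (h : NearInduced p X)
    (hXY : X ⊆ Y) : NearInduced p Y :=
  ⟨h.1, fun a ha b hb hab => (h.2 a ha b hb hab).imp_right fun h => hXY h⟩

theorem NearInduced.reverse {s t : V} {p : G.Walk s t} {X : Set (Sym2 V)} (h : NearInduced p X) :
    NearInduced p.reverse X := by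
  refine ⟨h.1.reverse, fun a ha b hb hab => ?_⟩
  rw [SimpleGraph.Walk.support_reverse, List.mem_reverse] at ha hb
  rw [SimpleGraph.Walk.edges_reverse, List.mem_reverse]
  exact h.2 a ha b hb hab

theorem NearInduced.glue {s t t' u : V} {p : G.Walk s t} {q : G.Walk t' u} {X : Set (Sym2 V)}
    (hp : NearInduced p X) (hq : NearInduced q X) (h : G.Adj t t')
    (hd : ∀ a ∈ p.support, a ∉ q.support)
    (hadj : ∀ a ∈ p.support, ∀ b ∈ q.support, G.Adj a b → (a = t ∧ b = t') ∨ s(a, b) ∈ X) :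
    NearInduced (p.append (.cons h q)) X := by
  have hsup : (p.append (.cons h q)).support = p.support ++ q.support := by
    rw [SimpleGraph.Walk.support_append, SimpleGraph.Walk.support_cons, List.tail_cons]
  have hcross : ∀ a ∈ p.support, ∀ b ∈ q.support, G.Adj a b →
      s(a, b) ∈ (p.append (.cons h q)).edges ∨ s(a, b) ∈ X := by
    intro a ha b hb hab
    rcases hadj a ha b hb hab with ⟨rfl, rfl⟩ | h'
    · left
      simp [SimpleGraph.Walk.edges_append]
    · exact Or.inr h'
  refine ⟨?_, ?_⟩
  · rw [SimpleGraph.Walk.isPath_def, hsup, List.nodup_append']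
    exact ⟨hp.1.support_nodup, hq.1.support_nodup, fun a ha hb => hd a ha hb⟩
  · intro a ha b hb hab
    rw [hsup, List.mem_append] at ha hb
    rcases ha with ha | ha <;> rcases hb with hb | hb
    · refine (hp.2 a ha b hb hab).imp_left fun h' => ?_
      simp [SimpleGraph.Walk.edges_append, h']
    · exact hcross a ha b hb hab
    · rw [Sym2.eq_swap]
      exact hcross b hb a ha hab.symm
    · refine (hq.2 a ha b hb hab).imp_left fun h' => ?_
      simp [SimpleGraph.Walk.edges_append, h']

theorem NearInduced.cons {t t' u : V} {q : G.Walk t' u} {X : Set (Sym2 V)} (hq : NearInduced q X)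
    (h : G.Adj t t') (ht : t ∉ q.support)
    (hadj : ∀ b ∈ q.support, G.Adj t b → b = t' ∨ s(t, b) ∈ X) : NearInduced (.cons h q) X := by
  refine (nearInduced_nil t X).glue hq h ?_ ?_
  · rintro a ha
    rw [SimpleGraph.Walk.support_nil, List.mem_singleton] at ha
    rwa [ha]
  · rintro a ha b hb hab
    rw [SimpleGraph.Walk.support_nil, List.mem_singleton] at ha
    subst ha
    exact (hadj b hb hab).imp_left fun h => ⟨rfl, h⟩

/-- Inside a set of vertices, a walk of minimum length is an induced path. -/
theorem exists_nearInduced_of_walk {s t : V} {X : Set V} (p₀ : G.Walk s t)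
    (h₀ : ∀ z ∈ p₀.support, z ∈ X) :
    ∃ p : G.Walk s t, NearInduced p ∅ ∧ ∀ z ∈ p.support, z ∈ X := by
  classical
  have hex : ∃ n, ∃ p : G.Walk s t, p.length = n ∧ ∀ z ∈ p.support, z ∈ X := ⟨_, p₀, rfl, h₀⟩
  obtain ⟨p', hp', hX'⟩ := Nat.find_spec hex
  have hmin : ∀ q : G.Walk s t, (∀ z ∈ q.support, z ∈ X) → Nat.find hex ≤ q.length :=
    fun q hq => Nat.find_min' hex ⟨q, rfl, hq⟩
  have hX : ∀ z ∈ p'.bypass.support, z ∈ X := fun z hz => hX' z (p'.support_bypass_subset_support hz)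
  have hlen : p'.bypass.length ≤ Nat.find hex := hp' ▸ p'.length_bypass_le_length
  generalize Nat.find hex = n at *
  have hpath := p'.bypass_isPath
  generalize p'.bypass = p at *
  have key : ∀ i j : ℕ, i < j → j ≤ p.length → G.Adj (p.getVert i) (p.getVert j) →
      s(p.getVert i, p.getVert j) ∈ p.edges := by
    intro i j hij hj hadj
    -- A chord between positions `i` and `j` would give a shorter walk unless `j = i + 1`.
    have h1 := hmin ((p.take i).append (.cons hadj (p.drop j))) (by
      intro z hz
      rw [SimpleGraph.Walk.mem_support_append_iff, SimpleGraph.Walk.support_cons, List.mem_cons] at hz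
      rcases hz with hz | rfl | hz
      · exact hX z ((p.isSubwalk_take i).support_subset hz)
      · exact hX _ (p.getVert_mem_support i)
      · exact hX z ((p.isSubwalk_drop j).support_subset hz))
    have h2 : j = i + 1 := by
      simp only [SimpleGraph.Walk.length_append, SimpleGraph.Walk.take_length,
        SimpleGraph.Walk.length_cons, SimpleGraph.Walk.drop_length] at h1
      omega
    subst h2
    rw [← SimpleGraph.Walk.adj_toSubgraph_iff_mem_edges]
    exact p.toSubgraph_adj_getVert (by omega)
  refine ⟨p, ⟨hpath, fun a ha b hb hab => Or.inl ?_⟩, hX⟩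
  obtain ⟨i, rfl, hi⟩ := SimpleGraph.Walk.mem_support_iff_exists_getVert.1 ha
  obtain ⟨j, rfl, hj⟩ := SimpleGraph.Walk.mem_support_iff_exists_getVert.1 hb
  rcases lt_trichotomy i j with h | rfl | h
  · exact key i j h hj hab
  · exact absurd hab (G.loopless.irrefl _)
  · rw [Sym2.eq_swap]; exact key j i h hi hab.symm

theorem exists_nearInduced {s t : V} {K : Set V} (hK : Linked G K) (hs : ∃ k ∈ K, G.Adj s k)
    (ht : ∃ k ∈ K, G.Adj t k) :
    ∃ p : G.Walk s t, NearInduced p ∅ ∧ ∀ z ∈ p.support, z = s ∨ z = t ∨ z ∈ K := by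
  obtain ⟨a, ha, hsa⟩ := hs
  obtain ⟨b, hb, htb⟩ := ht
  obtain ⟨w, hw⟩ := hK a ha b hb
  refine exists_nearInduced_of_walk (X := {z | z = s ∨ z = t ∨ z ∈ K}) (.cons hsa (w.concat htb.symm)) ?_
  intro z hz
  rw [SimpleGraph.Walk.support_cons, SimpleGraph.Walk.support_concat, List.mem_cons,
    List.mem_append, List.mem_singleton] at hz
  rcases hz with rfl | hz | rfl
  exacts [Or.inl rfl, Or.inr (Or.inr (hw z hz)), Or.inr (Or.inl rfl)]

/-- `I` is the set of internal vertices of an odd path from `s` to `t` that is induced except,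
possibly, for one internal chord in a triangle. -/
def IsRoute (G : SimpleGraph V) (s t : V) (I : Set V) : Prop :=
  ∃ p : G.Walk s t, Odd p.length ∧ 1 < p.length ∧ (∀ z, z ∈ p.support ↔ z = s ∨ z = t ∨ z ∈ I) ∧
    s ∉ I ∧ t ∉ I ∧ (NearInduced p ∅ ∨ ∃ u ∈ I, ∃ v ∈ I, ∃ w, s(u, w) ∈ p.edges ∧
      s(w, v) ∈ p.edges ∧ NearInduced p {s(u, v)})

theorem IsRoute.symm {s t : V} {I : Set V} (h : IsRoute G s t I) : IsRoute G t s I := by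
  obtain ⟨p, hodd, hlen, hsup, hs, ht, h⟩ := h
  refine ⟨p.reverse, by simpa using hodd, by simpa using hlen, fun z => ?_, ht, hs, ?_⟩
  · rw [SimpleGraph.Walk.support_reverse, List.mem_reverse, hsup]
    tauto
  · refine h.imp NearInduced.reverse ?_
    rintro ⟨u, hu, v, hv, w, h1, h2, h3⟩
    exact ⟨u, hu, v, hv, w, by simpa using h1, by simpa using h2, h3.reverse⟩

/-- The interior of a path gives a route. -/
theorem isRoute_of_walk {s t : V} (p : G.Walk s t) (hodd : Odd p.length) (hlen : 1 < p.length)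
    (h : NearInduced p ∅ ∨ ∃ u ∈ p.support, ∃ v ∈ p.support, u ≠ s ∧ u ≠ t ∧ v ≠ s ∧ v ≠ t ∧ ∃ w,
      s(u, w) ∈ p.edges ∧ s(w, v) ∈ p.edges ∧ NearInduced p {s(u, v)}) :
    IsRoute G s t {z | z ∈ p.support ∧ z ≠ s ∧ z ≠ t} := by
  refine ⟨p, hodd, hlen, fun z => ⟨fun hz => ?_, ?_⟩, fun h => h.2.1 rfl, fun h => h.2.2 rfl, ?_⟩
  · by_cases h1 : z = s
    · exact Or.inl h1
    · by_cases h2 : z = t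
      · exact Or.inr (Or.inl h2)
      · exact Or.inr (Or.inr ⟨hz, h1, h2⟩)
  · rintro (rfl | rfl | hz)
    exacts [p.start_mem_support, p.end_mem_support, hz.1]
  · refine h.imp_right ?_
    rintro ⟨u, hu, v, hv, h1, h2, h3, h4, w, h5⟩
    exact ⟨u, ⟨hu, h1, h2⟩, v, ⟨hv, h3, h4⟩, w, h5⟩

end Paths

/-! ### Odd routes through two covers -/

section Routes

variable {V W ι : Type*} {G : SimpleGraph V} {μ : Set V → ℝ} {ε : ℝ} {D : Finset W} {x : W → V}
  {K : ι → Set V} {p : ι → W → V} {C : Finset ι} {P : ι → Set V} {M : Set V}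

theorem Cfg.p_ne (h : Cfg G D x K p C P M) {c : ι} (hc : c ∈ C) {i j : W} (hi : i ∈ D) (hj : j ∈ D) :
    p c i ≠ x j := fun e => h.stable j hj i hi (e ▸ h.p_adj c hc i hi)

/-- An induced path from `x i` through the core of the cover `a` to the vertex `q` of the cover. -/
structure IsArm (G : SimpleGraph V) (x : W → V) (K : ι → Set V) (p : ι → W → V) (P : ι → Set V)
    (a : ι) (i : W) (q : V) (w : G.Walk (x i) q) : Prop where
  mem : q ∈ P a
  induced : NearInduced w ∅
  support : ∀ z ∈ w.support, z = x i ∨ z = p a i ∨ z = q ∨ z ∈ K a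

theorem Cfg.exists_arm (h : Cfg G D x K p C P M) {a : ι} (ha : a ∈ C) {i : W} (hi : i ∈ D) {q : V}
    (hq : q ∈ P a) : ∃ w : G.Walk (x i) q, IsArm G x K p P a i q w := by
  have hcov := h.cover a ha
  obtain ⟨w, hw, hsup⟩ := exists_nearInduced hcov.linked (h.p_attach a ha i hi) (hcov.attach q hq)
  have hsup' : ∀ z ∈ w.support, z = p a i ∨ z ∈ K a ∪ P a := fun z hz => by
    rcases hsup z hz with rfl | rfl | hz
    exacts [Or.inl rfl, Or.inr (Or.inr hq), Or.inr (Or.inl hz)]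
  refine ⟨.cons (h.p_adj a ha i hi).symm w, hq, hw.cons _ ?_ ?_, ?_⟩
  · intro hx
    rcases hsup' _ hx with e | e
    · exact h.p_ne ha hi hi e.symm
    · exact Set.disjoint_left.1 (h.x_hub_anti a ha i hi).1 rfl e
  · intro b hb hadj
    rcases hsup' _ hb with e | e
    · exact Or.inl e
    · exact absurd hadj ((h.x_hub_anti a ha i hi).2 _ rfl b e)
  · intro z hz
    rw [SimpleGraph.Walk.support_cons, List.mem_cons] at hz
    exact hz.imp_right (hsup z)

/-- Arms of constant parity end in a part of the cover that still covers half of the mass. -/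
theorem Cfg.exists_arms (h : Cfg G D x K p C P M) (hμ : IsMass μ) {a : ι} (ha : a ∈ C) {i : W}
    (hi : i ∈ D) {B : Set V} (hB : B ⊆ M) :
    ∃ (α : Prop) (L : Set V) (B' : Set V), B' ⊆ B ∧ μ B ≤ 2 * μ B' ∧ B' ⊆ nbhd G L ∧
      ∀ q ∈ L, ∃ w : G.Walk (x i) q, IsArm G x K p P a i q w ∧ (Even w.length ↔ α) := by
  set L : Prop → Set V := fun α =>
    {q | ∃ w : G.Walk (x i) q, IsArm G x K p P a i q w ∧ (Even w.length ↔ α)} with hL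
  have hcover : B ⊆ (B ∩ nbhd G (L True)) ∪ (B ∩ nbhd G (L False)) := by
    intro y hy
    obtain ⟨q, hq, hqy⟩ := (h.cover a ha).cover (hB hy)
    obtain ⟨w, hw⟩ := h.exists_arm ha hi hq
    by_cases hev : Even w.length
    · exact Or.inl ⟨hy, q, ⟨w, hw, by simpa using hev⟩, hqy⟩
    · exact Or.inr ⟨hy, q, ⟨w, hw, by simpa using hev⟩, hqy⟩
  have hmass := (hμ.mono _ _ hcover).trans (hμ.union_le _ _)
  rcases le_total (μ (B ∩ nbhd G (L True))) (μ (B ∩ nbhd G (L False))) with hle | hle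
  · exact ⟨False, L False, _, Set.inter_subset_left, by linarith, Set.inter_subset_right, fun q hq => hq⟩
  · exact ⟨True, L True, _, Set.inter_subset_left, by linarith, Set.inter_subset_right, fun q hq => hq⟩

/-- The hubs of `a` and `b` are separated, and in another hub `x i` sees at most its own connection
`p b i`, which is not on the arm of `j`. -/
theorem Cfg.arms_anti (h : Cfg G D x K p C P M) {a b : ι} (ha : a ∈ C) (hb : b ∈ C) (hab : a ≠ b)
    {i j : W} (hi : i ∈ D) (hj : j ∈ D) (hij : i ≠ j) :
    Anticomplete G ({x i} ∪ ({p a i} ∪ (K a ∪ P a))) ({x j} ∪ ({p b j} ∪ (K b ∪ P b))) := by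
  have hhub : ∀ c, ∀ l ∈ D, {p c l} ∪ (K c ∪ P c) ⊆ hub K p P D c := fun c l hl =>
    Set.union_subset (Set.singleton_subset_iff.2 (Or.inr ⟨l, hl, rfl⟩)) Set.subset_union_left
  have hx : ∀ c ∈ C, ∀ l ∈ D, ∀ k ∈ D, k ≠ l → Anticomplete G {x l} ({p c k} ∪ (K c ∪ P c)) := by
    intro c hc l hl k hk hkl
    refine Anticomplete.union_right ⟨?_, ?_⟩ (h.x_hub_anti c hc l hl)
    · exact Set.disjoint_singleton.2 (h.p_ne hc hk hl).symm
    · rintro _ rfl _ rfl hadj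
      exact h.p_not_adj c hc k hk l hl hkl hadj.symm
  refine Anticomplete.union_left (Anticomplete.union_right ⟨?_, ?_⟩ (hx b hb i hi j hj hij.symm))
    (Anticomplete.union_right (hx a ha j hj i hi hij).symm
      ((h.sep a ha b hb hab).mono (hhub a i hi) (hhub b j hj)))
  · exact Set.disjoint_singleton.2 fun e => hij (h.inj i hi j hj e)
  · rintro _ rfl _ rfl
    exact h.stable i hi j hj

theorem IsArm.mem_side {a : ι} {i : W} {q : V} {w : G.Walk (x i) q} (hw : IsArm G x K p P a i q w)
    {z : V} (hz : z ∈ w.support) : z ∈ ({x i} ∪ ({p a i} ∪ (K a ∪ P a)) : Set V) := by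
  rcases hw.support z hz with h | h | rfl | h
  exacts [Or.inl h, Or.inr (Or.inl h), Or.inr (Or.inr (Or.inr hw.mem)), Or.inr (Or.inr (Or.inl h))]

/-- Branch vertices, connections and cores are all anticomplete to `M`, so an arm can see the block
only from its leaf end. -/
theorem Cfg.arm_block (h : Cfg G D x K p C P M) {a : ι} (ha : a ∈ C) {i : W} (hi : i ∈ D) {q : V}
    {w : G.Walk (x i) q} (hw : IsArm G x K p P a i q w) {y : V} (hy : y ∈ M) {z : V}
    (hz : z ∈ w.support) : z ≠ y ∧ (G.Adj z y → z = q) := by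
  have key : ∀ Z : Set V, Anticomplete G Z M → z ∈ Z → z ≠ y ∧ (G.Adj z y → z = q) := fun Z hZ hz =>
    ⟨fun e => Set.disjoint_left.1 hZ.1 hz (e ▸ hy), fun hadj => absurd hadj (hZ.2 z hz y hy)⟩
  rcases hw.support z hz with hz | hz | rfl | hz
  · exact key _ (h.x_anti i hi) hz
  · exact key _ (h.p_anti a ha i hi) hz
  · exact ⟨fun e => Set.disjoint_left.1 (h.cover a ha).disj hw.mem (e ▸ hy), fun _ => rfl⟩
  · exact key _ (h.cover a ha).core hz

theorem Cfg.arm_cons (h : Cfg G D x K p C P M) {a : ι} (ha : a ∈ C) {i : W} (hi : i ∈ D) {q : V}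
    {w : G.Walk (x i) q} (hw : IsArm G x K p P a i q w) {y : V} (hy : y ∈ M) (hqy : G.Adj y q) :
    NearInduced (.cons hqy w.reverse) ∅ := by
  refine hw.induced.reverse.cons _ ?_ ?_ <;>
    simp only [SimpleGraph.Walk.support_reverse, List.mem_reverse]
  · exact fun hz => (h.arm_block ha hi hw hy hz).1 rfl
  · exact fun z hz hadj => Or.inl ((h.arm_block ha hi hw hy hz).2 hadj.symm)

theorem Cfg.route_of_vertex (h : Cfg G D x K p C P M) {a b : ι} (ha : a ∈ C) (hb : b ∈ C)
    (hab : a ≠ b) {i j : W} (hi : i ∈ D) (hj : j ∈ D) (hij : i ≠ j) {q q' y : V}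
    {w₁ : G.Walk (x i) q} {w₂ : G.Walk (x j) q'} (hw₁ : IsArm G x K p P a i q w₁)
    (hw₂ : IsArm G x K p P b j q' w₂) (hodd : Odd (w₁.length + w₂.length)) (hy : y ∈ M)
    (hqy : G.Adj q y) (hqy' : G.Adj y q') :
    ∃ I, IsRoute G (x i) (x j) I ∧
      ∀ z ∈ I, z = y ∨ z = q ∨ z = q' ∨ z ∈ (({p a i} ∪ K a) ∪ ({p b j} ∪ K b) : Set V) := by
  have hanti := h.arms_anti ha hb hab hi hj hij
  have g := hw₁.induced.glue (h.arm_cons hb hj hw₂ hy hqy') hqy (by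
    intro z hz hz'
    rw [SimpleGraph.Walk.support_cons, SimpleGraph.Walk.support_reverse, List.mem_cons,
      List.mem_reverse] at hz'
    rcases hz' with hz' | hz'
    · exact (h.arm_block ha hi hw₁ hy hz).1 hz'
    · exact Set.disjoint_left.1 hanti.1 (hw₁.mem_side hz) (hw₂.mem_side hz')) (by
    intro z hz z' hz' hadj
    rw [SimpleGraph.Walk.support_cons, SimpleGraph.Walk.support_reverse, List.mem_cons,
      List.mem_reverse] at hz'
    rcases hz' with rfl | hz'
    · exact Or.inl ⟨(h.arm_block ha hi hw₁ hy hz).2 hadj, rfl⟩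
    · exact absurd hadj (hanti.2 z (hw₁.mem_side hz) z' (hw₂.mem_side hz')))
  have hlen : (w₁.append (.cons hqy (.cons hqy' w₂.reverse))).length = w₁.length + w₂.length + 2 := by
    simp only [SimpleGraph.Walk.length_append, SimpleGraph.Walk.length_cons,
      SimpleGraph.Walk.length_reverse]
    ring
  refine ⟨_, isRoute_of_walk _ (hlen ▸ hodd.add_even (by decide)) (by omega) (Or.inl g), ?_⟩
  rintro z ⟨hz, hzi, hzj⟩
  rw [SimpleGraph.Walk.mem_support_append_iff, SimpleGraph.Walk.support_cons,
    SimpleGraph.Walk.support_cons, SimpleGraph.Walk.support_reverse, List.mem_cons, List.mem_cons,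
    List.mem_reverse] at hz
  simp only [Set.mem_union, Set.mem_singleton_iff]
  have h1 := hw₁.support z
  have h2 := hw₂.support z
  rcases hz with hz | rfl | rfl | hz
  · rcases h1 hz with e | e | e | e <;> simp_all
  · simp
  · simp
  · rcases h2 hz with e | e | e | e <;> simp_all

/-- The three connecting edges make the length odd. Of the possible chords, `q y'` is excluded by
`hnadj`; the remaining one, `y q'`, forms a triangle with the path edges at `y'`. -/
theorem Cfg.route_of_edge (h : Cfg G D x K p C P M) {a b : ι} (ha : a ∈ C) (hb : b ∈ C)
    (hab : a ≠ b) {i j : W} (hi : i ∈ D) (hj : j ∈ D) (hij : i ≠ j) {q q' y y' : V}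
    {w₁ : G.Walk (x i) q} {w₂ : G.Walk (x j) q'} (hw₁ : IsArm G x K p P a i q w₁)
    (hw₂ : IsArm G x K p P b j q' w₂) (heven : Even (w₁.length + w₂.length)) (hy : y ∈ M) (hy' : y' ∈ M)
    (hqy : G.Adj q y) (hyy' : G.Adj y y') (hqy' : G.Adj y' q') (hnadj : ¬ G.Adj q y') :
    ∃ I, IsRoute G (x i) (x j) I ∧
      ∀ z ∈ I, z = y ∨ z = y' ∨ z = q ∨ z = q' ∨
        z ∈ (({p a i} ∪ K a) ∪ ({p b j} ∪ K b) : Set V) := by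
  have hanti := h.arms_anti ha hb hab hi hj hij
  have g₁ := ((h.arm_cons hb hj hw₂ hy' hqy').mono (Set.empty_subset {s(y, q')})).cons hyy' (by
    rw [SimpleGraph.Walk.support_cons, SimpleGraph.Walk.support_reverse, List.mem_cons,
      List.mem_reverse, not_or]
    exact ⟨hyy'.ne, fun hz => (h.arm_block hb hj hw₂ hy hz).1 rfl⟩) (by
    intro z hz hadj
    rw [SimpleGraph.Walk.support_cons, SimpleGraph.Walk.support_reverse, List.mem_cons,
      List.mem_reverse] at hz
    rcases hz with hz | hz
    · exact Or.inl hz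
    · rw [(h.arm_block hb hj hw₂ hy hz).2 hadj.symm]
      exact Or.inr rfl)
  have g := (hw₁.induced.mono (Set.empty_subset _)).glue g₁ hqy (by
    intro z hz hz'
    rw [SimpleGraph.Walk.support_cons, SimpleGraph.Walk.support_cons,
      SimpleGraph.Walk.support_reverse, List.mem_cons, List.mem_cons, List.mem_reverse] at hz'
    rcases hz' with hz' | hz' | hz'
    · exact (h.arm_block ha hi hw₁ hy hz).1 hz'
    · exact (h.arm_block ha hi hw₁ hy' hz).1 hz'
    · exact Set.disjoint_left.1 hanti.1 (hw₁.mem_side hz) (hw₂.mem_side hz')) (by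
    intro z hz z' hz' hadj
    rw [SimpleGraph.Walk.support_cons, SimpleGraph.Walk.support_cons,
      SimpleGraph.Walk.support_reverse, List.mem_cons, List.mem_cons, List.mem_reverse] at hz'
    rcases hz' with rfl | rfl | hz'
    · exact Or.inl ⟨(h.arm_block ha hi hw₁ hy hz).2 hadj, rfl⟩
    · have e := (h.arm_block ha hi hw₁ hy' hz).2 hadj
      exact absurd (e ▸ hadj) hnadj
    · exact absurd hadj (hanti.2 z (hw₁.mem_side hz) z' (hw₂.mem_side hz')))
  have hlen : (w₁.append (.cons hqy (.cons hyy' (.cons hqy' w₂.reverse)))).length =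
      w₁.length + w₂.length + 3 := by
    simp only [SimpleGraph.Walk.length_append, SimpleGraph.Walk.length_cons,
      SimpleGraph.Walk.length_reverse]
    ring
  have hyx : ∀ l ∈ D, y ≠ x l := fun l hl e => Set.disjoint_left.1 (h.x_anti l hl).1 e hy
  have hqx : ∀ l ∈ D, q' ≠ x l := fun l hl e =>
    Set.disjoint_left.1 (h.x_hub_anti b hb l hl).1 e (Or.inr hw₂.mem)
  refine ⟨_, isRoute_of_walk _ (hlen ▸ heven.add_odd (by decide)) (by omega) (Or.inr ⟨y, ?_, q', ?_,
    hyx i hi, hyx j hj, hqx i hi, hqx j hj, y', ?_, ?_, g⟩), ?_⟩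
  · simp
  · simp
  · simp
  · simp
  · rintro z ⟨hz, hzi, hzj⟩
    rw [SimpleGraph.Walk.mem_support_append_iff, SimpleGraph.Walk.support_cons,
      SimpleGraph.Walk.support_cons, SimpleGraph.Walk.support_cons, SimpleGraph.Walk.support_reverse,
      List.mem_cons, List.mem_cons, List.mem_cons, List.mem_reverse] at hz
    simp only [Set.mem_union, Set.mem_singleton_iff]
    have h1 := hw₁.support z
    have h2 := hw₂.support z
    rcases hz with hz | rfl | rfl | rfl | hz
    · rcases h1 hz with e | e | e | e <;> simp_all
    · simp
    · simp
    · simp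
    · rcases h2 hz with e | e | e | e <;> simp_all

theorem Cfg.exists_route [Finite V] (h : Cfg G D x K p C P M) (hμ : IsMass μ)
    (hc : IsCoherent G μ ε) {a b : ι} (ha : a ∈ C) (hb : b ∈ C) (hab : a ≠ b) {i j : W} (hi : i ∈ D)
    (hj : j ∈ D) (hij : i ≠ j) {B : Set V} (hB : B ⊆ M) (hBm : 12 * ε ≤ μ B) :
    ∃ (I : Set V) (s : Finset V), IsRoute G (x i) (x j) I ∧
      I ⊆ s ∪ (({p a i} ∪ K a) ∪ ({p b j} ∪ K b)) ∧ (s : Set V) ⊆ P a ∪ P b ∪ B ∧ s.card ≤ 4 := by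
  classical
  have hε := hc.pos hμ
  obtain ⟨α, La, B₁, hB₁, hm₁, hcov₁, harm₁⟩ := h.exists_arms hμ ha hi hB
  obtain ⟨β, Lb, B₂, hB₂, hm₂, hcov₂, harm₂⟩ := h.exists_arms hμ hb hj (hB₁.trans hB)
  by_cases hαβ : α ↔ β
  -- Equal parities. Two halvings of `12 * ε` leave `3 * ε` in `B₂`, so a threshold cover at level
  -- `ε` leaves mass at least `ε` both inside and outside its neighbourhood; coherence gives an edge
  -- across.
  · obtain ⟨Q, hQ, ⟨-, -, hQ1⟩, hQ2⟩ := exists_threshold_cover hμ hc {()} (fun _ => B₂) hε (L := La)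
      ⟨(), by simp, by rw [Set.inter_eq_left.2 (hB₂.trans hcov₁)]; linarith⟩
    have hQ2 := hQ2 () (by simp)
    obtain ⟨y, ⟨hyB, q, hq, hqy⟩, y', ⟨hyB', hy'⟩, hyy'⟩ :
        ∃ y ∈ B₂ ∩ nbhd G Q, ∃ y' ∈ B₂ \ nbhd G Q, G.Adj y y' := by
      by_contra! hno
      have := hc.anticomplete_lt (B₂ ∩ nbhd G Q) (B₂ \ nbhd G Q)
        ⟨Set.disjoint_left.2 fun z hz hz' => hz'.2 hz.2, hno⟩
      rcases min_lt_iff.1 this with h | h <;> linarith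
    obtain ⟨q', hq', hqy'⟩ := hcov₂ hyB'
    obtain ⟨w₁, hw₁, hp₁⟩ := harm₁ q (hQ hq)
    obtain ⟨w₂, hw₂, hp₂⟩ := harm₂ q' hq'
    obtain ⟨I, hI, hIs⟩ := h.route_of_edge ha hb hab hi hj hij hw₁ hw₂
      (by rw [Nat.even_add, hp₁, hp₂]; exact hαβ) (hB (hB₁ (hB₂ hyB))) (hB (hB₁ (hB₂ hyB'))) hqy hyy'
      hqy'.symm fun e => hy' ⟨q, hq, e⟩
    refine ⟨I, {y, y', q, q'}, hI, fun z hz => ?_, ?_, Finset.card_le_four⟩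
    · rcases hIs z hz with rfl | rfl | rfl | rfl | hz
      · simp
      · simp
      · simp
      · simp
      · exact Or.inr hz
    · simp only [Finset.coe_insert, Finset.coe_singleton, Set.insert_subset_iff,
        Set.singleton_subset_iff]
      exact ⟨Or.inr (hB₁ (hB₂ hyB)), Or.inr (hB₁ (hB₂ hyB')), Or.inl (Or.inl hw₁.mem),
        Or.inl (Or.inr hw₂.mem)⟩
  · obtain ⟨y, hyB⟩ := hμ.nonempty_of_pos (X := B₂) (by linarith)
    obtain ⟨q, hq, hqy⟩ := hcov₁ (hB₂ hyB)
    obtain ⟨q', hq', hqy'⟩ := hcov₂ hyB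
    obtain ⟨w₁, hw₁, hp₁⟩ := harm₁ q hq
    obtain ⟨w₂, hw₂, hp₂⟩ := harm₂ q' hq'
    obtain ⟨I, hI, hIs⟩ := h.route_of_vertex ha hb hab hi hj hij hw₁ hw₂
      (by rw [← Nat.not_even_iff_odd, Nat.even_add, hp₁, hp₂]; exact hαβ) (hB (hB₁ (hB₂ hyB))) hqy
      hqy'.symm
    refine ⟨I, {y, q, q'}, hI, fun z hz => ?_, ?_, Finset.card_le_three.trans (by norm_num)⟩
    · rcases hIs z hz with rfl | rfl | rfl | hz
      · simp
      · simp
      · simp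
      · exact Or.inr hz
    · simp only [Finset.coe_insert, Finset.coe_singleton, Set.insert_subset_iff,
        Set.singleton_subset_iff]
      exact ⟨Or.inr (hB₁ (hB₂ hyB)), Or.inl (Or.inl hw₁.mem), Or.inl (Or.inr hw₂.mem)⟩

end Routes

/-! ### Choosing the routes one after another -/

section Selection

variable {V W ι : Type*} {G : SimpleGraph V} {μ : Set V → ℝ} {ε : ℝ} {D : Finset W} {x : W → V}
  {K : ι → Set V} {p : ι → W → V} {C : Finset ι} {P : ι → Set V} {M : Set V}

/-- All vertices, other than the `x w`, that a configuration can use. -/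
def territory (K : ι → Set V) (p : ι → W → V) (D : Finset W) (C : Finset ι) (P : ι → Set V)
    (M : Set V) : Set V :=
  {z | z ∈ M ∨ ∃ c ∈ C, z ∈ hub K p P D c}

theorem territory_mono {C' : Finset ι} {P' : ι → Set V} {M' : Set V} (hC : C' ⊆ C) (hM : M' ⊆ M)
    (hP : ∀ c ∈ C', P' c ⊆ P c) : territory K p D C' P' M' ⊆ territory K p D C P M := by
  rintro z (hz | ⟨c, hc, hz⟩)
  · exact Or.inl (hM hz)
  · exact Or.inr ⟨c, hC hc, Set.union_subset_union_left _ (Set.union_subset_union_right _ (hP c hc)) hz⟩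

/-- Two covers `a`, `b` are reserved for the route and the remaining `2 * N` are split. The route
crosses the block inside `B`, which the thinned covers miss, so it cannot interfere with the
configuration that survives on `A`. -/
theorem Cfg.route_step [Finite V] (h : Cfg G D x K p C P M) (hμ : IsMass μ) (hc : IsCoherent G μ ε)
    {N m : ℕ} (hC : C.card = 2 * N + 2) (hM : (3 ^ (2 * N + 1) * (m + 12) : ℕ) * ε ≤ μ M) {i j : W}
    (hi : i ∈ D) (hj : j ∈ D) (hij : i ≠ j) :
    ∃ (I : Set V) (C' : Finset ι) (P' : ι → Set V) (M' : Set V), Cfg G D x K p C' P' M' ∧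
      C'.card = N ∧ m * ε ≤ μ M' ∧ territory K p D C' P' M' ⊆ territory K p D C P M ∧
      IsRoute G (x i) (x j) I ∧ I ⊆ territory K p D C P M ∧
      Anticomplete G I (territory K p D C' P' M') ∧
      ∀ w ∈ D, w ≠ i → w ≠ j → Anticomplete G {x w} I := by
  classical
  have hε := hc.pos hμ
  have hm0 : (0 : ℝ) ≤ m * ε := by positivity
  obtain ⟨a, b, ha, hb, hab⟩ := Finset.one_lt_card_iff.1 (show 1 < C.card by omega)
  have hC₀ : ((C.erase a).erase b).card = 2 * N := by
    rw [Finset.card_erase_of_mem (Finset.mem_erase.2 ⟨hab.symm, hb⟩), Finset.card_erase_of_mem ha]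
    omega
  obtain ⟨A, hA, B, hB, hAB, hmA, hmB, C', hC', hcard, P', hP'⟩ := exists_split hμ hc
    (b := (m + 12) * ε) (by linarith) P hC₀ (M := M) (by push_cast at hM; linarith)
    fun c hc => (h.cover c (Finset.mem_of_mem_erase (Finset.mem_of_mem_erase hc))).cover
  have hsub : ∀ c ∈ C', c ∈ C ∧ c ≠ a ∧ c ≠ b := fun c hc => by
    have := hC' hc
    simp only [Finset.mem_erase] at this
    exact ⟨this.2.2, this.2.1, this.1⟩
  obtain ⟨I, s, hI, hIs, hs, hs4⟩ := h.exists_route hμ hc ha hb hab hi hj hij hB (by linarith)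
  -- Only the leaves and block vertices of the route, at most four, can have neighbours in `A`; its
  -- connections and cores are anticomplete to `M`.
  have hA' := hc.mass_diff_nbhd hμ (A := A) (m := m * ε) (n := 4) (by push_cast; linarith) s hs4
  have hMA : A \ nbhd G (s : Set V) ⊆ M := Set.sdiff_subset.trans hA
  have hI' : I ⊆ (hub K p P D a ∪ hub K p P D b) ∪ B := by
    intro z hz
    rcases hIs hz with hz | (rfl | hz) | (rfl | hz)
    · rcases hs hz with (hz | hz) | hz
      · exact Or.inl (Or.inl (Or.inl (Or.inr hz)))
      · exact Or.inl (Or.inr (Or.inl (Or.inr hz)))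
      · exact Or.inr hz
    · exact Or.inl (Or.inl (Or.inr ⟨i, hi, rfl⟩))
    · exact Or.inl (Or.inl (Or.inl (Or.inl hz)))
    · exact Or.inl (Or.inr (Or.inr ⟨j, hj, rfl⟩))
    · exact Or.inl (Or.inr (Or.inl (Or.inl hz)))
  have hIhub : ∀ c ∈ C', Anticomplete G I (hub K p P' D c) := by
    intro c hcC
    obtain ⟨hcC₀, hca, hcb⟩ := hsub c hcC
    have hle : hub K p P' D c ⊆ hub K p P D c :=
      Set.union_subset_union_left _ (Set.union_subset_union_right _ (hP' c hcC).1)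
    have hBc : Anticomplete G B (hub K p P' D c) := by
      refine Anticomplete.union_right (Anticomplete.union_right
        ((h.cover c hcC₀).core.symm.mono hB subset_rfl)
        ⟨(h.cover c hcC₀).disj.symm.mono hB (hP' c hcC).1, ?_⟩) ⟨?_, ?_⟩
      · exact fun z hz q hq hadj => Set.disjoint_left.1 (hP' c hcC).2.2 hz ⟨q, hq, hadj.symm⟩
      · rw [Set.disjoint_right]
        rintro _ ⟨w, hw, rfl⟩ hz
        exact Set.disjoint_left.1 (h.p_anti c hcC₀ w hw).1 rfl (hB hz)
      · rintro z hz _ ⟨w, hw, rfl⟩ hadj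
        exact (h.p_anti c hcC₀ w hw).2 _ rfl z (hB hz) hadj.symm
    exact (Anticomplete.union_left (Anticomplete.union_left (h.sep a ha c hcC₀ hca.symm)
      (h.sep b hb c hcC₀ hcb.symm) |>.mono subset_rfl hle) hBc).mono hI' subset_rfl
  have hIA : Anticomplete G I (A \ nbhd G (s : Set V)) := by
    refine Anticomplete.mono (Anticomplete.union_left ⟨?_, ?_⟩ ((Anticomplete.union_left
      (Anticomplete.union_left (h.p_anti a ha i hi) (h.cover a ha).core)
      (Anticomplete.union_left (h.p_anti b hb j hj) (h.cover b hb).core)).mono subset_rfl hMA))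
      hIs subset_rfl
    · rw [Set.disjoint_left]
      intro z hz hzA
      rcases hs hz with (hz | hz) | hz
      · exact Set.disjoint_left.1 (h.cover a ha).disj hz (hMA hzA)
      · exact Set.disjoint_left.1 (h.cover b hb).disj hz (hMA hzA)
      · exact Set.disjoint_left.1 hAB hzA.1 hz
    · exact fun z hz y hy hadj => hy.2 ⟨z, hz, hadj⟩
  refine ⟨I, C', P', A \ nbhd G (s : Set V), h.mono (fun c hc => (hsub c hc).1) hMA fun c hc =>
    ⟨(hP' c hc).1, Set.sdiff_subset.trans (hP' c hc).2.1⟩, hcard, hA',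
    territory_mono (fun c hc => (hsub c hc).1) hMA fun c hc => (hP' c hc).1, hI, ?_, ⟨?_, ?_⟩, ?_⟩
  · intro z hz
    rcases hI' hz with (hz | hz) | hz
    exacts [Or.inr ⟨a, ha, hz⟩, Or.inr ⟨b, hb, hz⟩, Or.inl (hB hz)]
  · rw [Set.disjoint_left]
    rintro z hz (hz' | ⟨c, hcC, hz'⟩)
    · exact Set.disjoint_left.1 hIA.1 hz hz'
    · exact Set.disjoint_left.1 (hIhub c hcC).1 hz hz'
  · rintro z hz y (hy | ⟨c, hcC, hy⟩)
    · exact hIA.2 z hz y hy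
    · exact (hIhub c hcC).2 z hz y hy
  · intro w hw hwi hwj
    have hxp : ∀ c ∈ C, ∀ l ∈ D, w ≠ l → Anticomplete G {x w} {p c l} := fun c hc l hl hwl =>
      ⟨Set.disjoint_singleton.2 (h.p_ne hc hl hw).symm, by
        rintro _ rfl _ rfl hadj
        exact h.p_not_adj c hc l hl w hw hwl.symm hadj.symm⟩
    have hxK : ∀ c ∈ C, Anticomplete G {x w} (K c) := fun c hc =>
      (h.x_hub_anti c hc w hw).mono subset_rfl Set.subset_union_left
    have hxP : ∀ c ∈ C, Anticomplete G {x w} (P c) := fun c hc =>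
      (h.x_hub_anti c hc w hw).mono subset_rfl Set.subset_union_right
    exact (Anticomplete.union_right (((hxP a ha).union_right (hxP b hb)).union_right
      ((h.x_anti w hw).mono subset_rfl hB) |>.mono subset_rfl hs)
      (((hxp a ha i hi hwi).union_right (hxK a ha)).union_right
      ((hxp b hb j hj hwj).union_right (hxK b hb)))).mono subset_rfl hIs

end Selection

/-- In a rich configuration, all prescribed pairs of branch vertices can be joined by pairwise
anticomplete routes. -/
theorem exists_routes.{u, v, w} {W : Type v} (D : Finset W) (E : Finset (W × W))
    (hE : ∀ e ∈ E, e.1 ∈ D ∧ e.2 ∈ D ∧ e.1 ≠ e.2) : ∃ N m : ℕ,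
    ∀ (V : Type u) [Finite V] (ι : Type w) (G : SimpleGraph V) (μ : Set V → ℝ) (ε : ℝ), IsMass μ →
    IsCoherent G μ ε → ∀ (x : W → V) (K : ι → Set V) (p : ι → W → V) (C : Finset ι) (P : ι → Set V)
    (M : Set V), Cfg G D x K p C P M → C.card = N → m * ε ≤ μ M →
    ∃ I : W × W → Set V, ∀ e ∈ E, IsRoute G (x e.1) (x e.2) (I e) ∧ I e ⊆ territory K p D C P M ∧
      (∀ w ∈ D, w ≠ e.1 → w ≠ e.2 → Anticomplete G {x w} (I e)) ∧
      ∀ f ∈ E, e ≠ f → Anticomplete G (I e) (I f) := by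
  classical
  induction E using Finset.induction_on with
  | empty => exact ⟨0, 0, fun V _ ι G μ ε _ _ x K p C P M _ _ _ => ⟨fun _ => ∅, by simp⟩⟩
  | insert e E he ih =>
    obtain ⟨N, m, H⟩ := ih fun f hf => hE f (Finset.mem_insert_of_mem hf)
    refine ⟨2 * N + 2, 3 ^ (2 * N + 1) * (m + 12), fun V _ ι G μ ε hμ hc x K p C P M h hC hM => ?_⟩
    obtain ⟨hi, hj, hij⟩ := hE e (Finset.mem_insert_self _ _)
    obtain ⟨I₀, C', P', M', h', hC', hM', hsub, hI₀, hI₀sub, hanti, hx⟩ :=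
      h.route_step hμ hc hC hM hi hj hij
    obtain ⟨I, hI⟩ := H V ι G μ ε hμ hc x K p C' P' M' h' hC' hM'
    have hne : ∀ f ∈ E, f ≠ e := fun f hf hfe => he (hfe ▸ hf)
    have hI₀f : ∀ f ∈ E, Anticomplete G I₀ (I f) := fun f hf => hanti.mono subset_rfl (hI f hf).2.1
    refine ⟨Function.update I e I₀, fun f hf => ?_⟩
    by_cases hfe : f = e
    · subst hfe
      rw [Function.update_self]
      refine ⟨hI₀, hI₀sub, hx, fun g hg hfg => ?_⟩
      rw [Function.update_of_ne hfg.symm]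
      exact hI₀f g (Finset.mem_of_mem_insert_of_ne hg hfg.symm)
    · rw [Function.update_of_ne hfe]
      have hfE := Finset.mem_of_mem_insert_of_ne hf hfe
      obtain ⟨h1, h2, h3, h4⟩ := hI f hfE
      refine ⟨h1, h2.trans hsub, h3, fun g hg hfg => ?_⟩
      by_cases hge : g = e
      · subst hge
        rw [Function.update_self]
        exact (hI₀f f hfE).symm
      · rw [Function.update_of_ne hge]
        exact h4 g (Finset.mem_of_mem_insert_of_ne hg hge) hfg

/-! ### From anticomplete routes to an induced subdivision -/

section Assembly

variable {V W : Type*} {G : SimpleGraph V}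

theorem IsFuzzyOddPath.symm {U : Type*} {J : SimpleGraph U} {F : J.Subgraph} {s t : U} {n : ℕ}
    (h : IsFuzzyOddPath F s t n) : IsFuzzyOddPath F t s n := by
  obtain ⟨p, hp, hlen, hodd, hF⟩ := h
  refine ⟨p.reverse, hp.reverse, by simpa using hlen, hodd, ?_⟩
  rw [SimpleGraph.Walk.toSubgraph_reverse]
  refine hF.imp_right ?_
  rintro ⟨u, v, w, huv, h1, h2, h3, h4, h5, h6, h7⟩
  exact ⟨u, v, w, huv, by simpa using h1, h3, h2, by simpa using h4, h6, h5, h7⟩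

theorem IsRoute.exists_isFuzzyOddPath {S : Set V} {s t : S} {I : Set V} (h : IsRoute G s t I)
    (hIS : I ⊆ S) : ∃ (F : (G.induce S).Subgraph) (n : ℕ), 1 < n ∧ IsFuzzyOddPath F s t n ∧
      (∀ z : S, z ∈ F.verts ↔ z = s ∨ z = t ∨ (z : V) ∈ I) ∧
      ∀ u ∈ F.verts, ∀ v ∈ F.verts, G.Adj u v → F.Adj u v := by
  obtain ⟨p, hodd, hlen, hsup, hs, ht, hp⟩ := h
  have hpS : ∀ z ∈ p.support, z ∈ S := fun z hz => by
    rcases (hsup z).1 hz with rfl | rfl | hz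
    exacts [s.2, t.2, hIS hz]
  obtain ⟨q, hq⟩ : ∃ q : (G.induce S).Walk s t, q.map (SimpleGraph.Embedding.induce S).toHom = p :=
    ⟨p.induce S hpS, p.map_induce hpS⟩
  have hinj : Function.Injective (SimpleGraph.Embedding.induce (G := G) S).toHom :=
    Subtype.val_injective
  have hqlen : q.length = p.length := by
    rw [← hq]; exact (SimpleGraph.Walk.length_map _ q).symm
  have hqsup : ∀ z : S, z ∈ q.support ↔ (z : V) ∈ p.support := fun z => by
    have e : p.support = q.support.map (SimpleGraph.Embedding.induce (G := G) S).toHom := by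
      rw [← SimpleGraph.Walk.support_map]; exact (congrArg SimpleGraph.Walk.support hq).symm
    rw [e]
    exact (List.mem_map_of_injective hinj).symm
  have hqedge : ∀ u v : S, s(u, v) ∈ q.edges ↔ s((u : V), (v : V)) ∈ p.edges := fun u v => by
    have e : p.edges = q.edges.map (Sym2.map (SimpleGraph.Embedding.induce (G := G) S).toHom) := by
      rw [← SimpleGraph.Walk.edges_map]; exact (congrArg SimpleGraph.Walk.edges hq).symm
    rw [e]
    exact (List.mem_map_of_injective (Sym2.map.injective hinj)
      (a := s(u, v))).symm
  have hqpath : p.IsPath → q.IsPath := fun h => by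
    rw [← hq] at h
    exact h.of_map
  have hqsup' : ∀ z : S, z ∈ q.support ↔ z = s ∨ z = t ∨ (z : V) ∈ I := fun z => by
    rw [hqsup, hsup, Subtype.ext_iff, Subtype.ext_iff]
  have hplain : p.IsPath → (∀ a ∈ p.support, ∀ b ∈ p.support, G.Adj a b → s(a, b) ∈ p.edges) →
      ∃ (F : (G.induce S).Subgraph) (n : ℕ), 1 < n ∧ IsFuzzyOddPath F s t n ∧
      (∀ z : S, z ∈ F.verts ↔ z = s ∨ z = t ∨ (z : V) ∈ I) ∧
      ∀ u ∈ F.verts, ∀ v ∈ F.verts, G.Adj u v → F.Adj u v := by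
    refine fun hpath hind => ⟨q.toSubgraph, q.length, hqlen ▸ hlen, ⟨q, hqpath hpath, rfl,
      hqlen ▸ hodd, Or.inl rfl⟩, fun z => ?_, fun u hu v hv huv => ?_⟩
    · rw [SimpleGraph.Walk.mem_verts_toSubgraph, hqsup']
    · rw [SimpleGraph.Walk.mem_verts_toSubgraph, hqsup] at hu hv
      rw [SimpleGraph.Walk.adj_toSubgraph_iff_mem_edges, hqedge]
      exact hind u hu v hv huv
  rcases hp with ⟨hpath, hind⟩ | ⟨u, hu, v, hv, w, huw, hwv, hpath, hind⟩
  · exact hplain hpath fun a ha b hb hab => (hind a ha b hb hab).resolve_right fun h => h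
  · by_cases huv : G.Adj u v ∧ s(u, v) ∉ p.edges
    · obtain ⟨hadj, hno⟩ := huv
      have hw : w ∈ S := hpS w (p.snd_mem_support_of_mem_edges huw)
      have huq : (⟨u, hIS hu⟩ : S) ∈ q.support := (hqsup' _).2 (Or.inr (Or.inr hu))
      have hvq : (⟨v, hIS hv⟩ : S) ∈ q.support := (hqsup' _).2 (Or.inr (Or.inr hv))
      have hJ : (G.induce S).Adj ⟨u, hIS hu⟩ ⟨v, hIS hv⟩ := hadj
      refine ⟨q.toSubgraph ⊔ (G.induce S).subgraphOfAdj hJ, q.length, hqlen ▸ hlen,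
        ⟨q, hqpath hpath, rfl, hqlen ▸ hodd, Or.inr ⟨⟨u, hIS hu⟩, ⟨v, hIS hv⟩, ⟨w, hw⟩, hJ, huq,
        ?_, ?_, hvq, ?_, ?_, ?_, ?_, ?_, rfl⟩⟩, fun z => ?_, fun a ha b hb hab => ?_⟩
      · rintro rfl; exact hs hu
      · rintro rfl; exact ht hu
      · rintro rfl; exact hs hv
      · rintro rfl; exact ht hv
      · rwa [SimpleGraph.Walk.adj_toSubgraph_iff_mem_edges, hqedge]
      · rwa [SimpleGraph.Walk.adj_toSubgraph_iff_mem_edges, hqedge]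
      · rwa [SimpleGraph.Walk.adj_toSubgraph_iff_mem_edges, hqedge]
      · rw [SimpleGraph.Subgraph.verts_sup, Set.mem_union, SimpleGraph.Walk.mem_verts_toSubgraph,
          ← hqsup']
        refine ⟨?_, Or.inl⟩
        rintro (hz | rfl | rfl)
        exacts [hz, huq, hvq]
      · have hverts : ∀ z ∈ (q.toSubgraph ⊔ (G.induce S).subgraphOfAdj hJ).verts,
            (z : V) ∈ p.support := by
          rintro z (hz | rfl | rfl)
          · exact (hqsup z).1 ((SimpleGraph.Walk.mem_verts_toSubgraph _).1 hz)
          · exact (hqsup _).1 huq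
          · exact (hqsup _).1 hvq
        rw [SimpleGraph.Subgraph.sup_adj, SimpleGraph.Walk.adj_toSubgraph_iff_mem_edges, hqedge]
        refine (hind a (hverts a ha) b (hverts b hb) hab).imp_right fun h => ?_
        rw [Set.mem_singleton_iff, Sym2.eq_iff] at h
        rw [SimpleGraph.subgraphOfAdj_adj, Sym2.eq_iff]
        simp only [Subtype.ext_iff]
        tauto
    · refine hplain hpath fun a ha b hb hab => (hind a ha b hb hab).elim id fun h => ?_
      rw [Set.mem_singleton_iff] at h
      rw [h]
      by_contra hno
      refine huv ⟨?_, hno⟩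
      rw [← SimpleGraph.mem_edgeSet] at hab ⊢
      rwa [← h]

/-- Anticompleteness leaves no edge except between vertices of the same replacing path, and each
such path contains every edge of `G` among its vertices. -/
theorem exists_isProperFuzzyOddSubdivision {H : SimpleGraph W} {x : W → V}
    (hinj : Function.Injective x) (hstable : ∀ w w', ¬ G.Adj (x w) (x w')) (I : H.edgeSet → Set V)
    (hroute : ∀ (a b : W) (h : H.Adj a b), IsRoute G (x a) (x b) (I ⟨s(a, b), h⟩))
    (hx : ∀ (e : H.edgeSet) (w : W), w ∉ (e : Sym2 W) → Anticomplete G {x w} (I e))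
    (hI : ∀ e f, e ≠ f → Anticomplete G (I e) (I f)) :
    ∃ S : Set V, IsProperFuzzyOddSubdivision (G.induce S) H := by
  set S : Set V := Set.range x ∪ ⋃ e, I e with hS
  have hIS : ∀ e, I e ⊆ S := fun e => (Set.subset_iUnion I e).trans Set.subset_union_right
  let φ : W ↪ S := ⟨fun w => ⟨x w, Or.inl ⟨w, rfl⟩⟩, fun a b h => hinj (Subtype.ext_iff.1 h)⟩
  have hF : ∀ e : H.edgeSet, ∃ F : (G.induce S).Subgraph,
      (∀ (a b : W), s(a, b) = (e : Sym2 W) → ∃ n, 1 < n ∧ IsFuzzyOddPath F (φ a) (φ b) n) ∧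
      (∀ z : S, z ∈ F.verts ↔ (∃ w ∈ (e : Sym2 W), z = φ w) ∨ (z : V) ∈ I e) ∧
      ∀ u ∈ F.verts, ∀ v ∈ F.verts, G.Adj u v → F.Adj u v := by
    rintro ⟨e, he⟩
    induction e using Sym2.ind with
    | _ a b =>
    obtain ⟨F, n, hn, hfuz, hverts, hind⟩ :=
      IsRoute.exists_isFuzzyOddPath (s := φ a) (t := φ b) (hroute a b he) (hIS _)
    refine ⟨F, fun a' b' h => ⟨n, hn, ?_⟩, fun z => ?_, hind⟩
    · rcases Sym2.eq_iff.1 h with ⟨rfl, rfl⟩ | ⟨rfl, rfl⟩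
      exacts [hfuz, hfuz.symm]
    · rw [hverts]
      simp [Sym2.mem_iff, or_assoc]
  choose P hP hverts hind using hF
  refine ⟨S, φ, P, fun a b h => hP ⟨s(a, b), h⟩ a b rfl, ?_, ?_, ?_, ?_⟩
  · intro e w hw
    by_contra hwe
    rcases (hverts e _).1 hw with ⟨w', hw', h⟩ | h
    · exact hwe (φ.injective h ▸ hw')
    · exact Set.disjoint_left.1 (hx e w hwe).1 rfl h
  · rintro e f hef z ⟨hze, hzf⟩
    rcases (hverts e z).1 hze with ⟨w, -, rfl⟩ | h
    · exact ⟨w, rfl⟩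
    · rcases (hverts f z).1 hzf with ⟨w, -, rfl⟩ | h'
      · exact ⟨w, rfl⟩
      · exact absurd h' (Set.disjoint_left.1 (hI e f hef).1 h)
  · rintro ⟨z, ⟨w, rfl⟩ | hz⟩
    · exact Or.inl ⟨w, rfl⟩
    · obtain ⟨e, he⟩ := Set.mem_iUnion.1 hz
      exact Or.inr ⟨e, (hverts e _).2 (Or.inr he)⟩
  · have hmix : ∀ (w : W) (hw : x w ∈ S) (z : V) (hz : z ∈ S) (e : H.edgeSet), z ∈ I e →
        G.Adj (x w) z → (P e).Adj ⟨x w, hw⟩ ⟨z, hz⟩ := by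
      intro w hw z hz e hze hadj
      refine hind e _ ((hverts e _).2 (Or.inl ⟨w, ?_, rfl⟩)) _ ((hverts e _).2 (Or.inr hze)) hadj
      by_contra hwe
      exact (hx e w hwe).2 _ rfl z hze hadj
    rintro ⟨y, hy⟩ ⟨z, hz⟩ hyz
    have hadj : G.Adj y z := hyz
    rcases hy with ⟨w, rfl⟩ | hy' <;> rcases hz with ⟨w', rfl⟩ | hz'
    · exact absurd hadj (hstable w w')
    · obtain ⟨e, he⟩ := Set.mem_iUnion.1 hz'
      exact ⟨e, hmix w _ z _ e he hadj⟩
    · obtain ⟨e, he⟩ := Set.mem_iUnion.1 hy'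
      exact ⟨e, (hmix w' _ y _ e he hadj.symm).symm⟩
    · obtain ⟨e, he⟩ := Set.mem_iUnion.1 hy'
      obtain ⟨f, hf⟩ := Set.mem_iUnion.1 hz'
      by_cases hef : e = f
      · subst hef
        exact ⟨e, hind e _ ((hverts e _).2 (Or.inr he)) _ ((hverts e _).2 (Or.inr hf)) hadj⟩
      · exact absurd hadj ((hI e f hef).2 y he z hf)

end Assembly

theorem mainTheorem12 {W : Type*} [Finite W] (H : SimpleGraph W) (r : ℕ) (hr : 1 ≤ r) :
    ∃ ε : ℝ, 0 < ε ∧ ∃ δ : ℝ, 0 < δ ∧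
      ∀ (V : Type*) [Finite V] (G : SimpleGraph V) (μ : Set V → ℝ),
        IsMass μ → IsFocused G μ δ r → IsCoherent G μ ε →
          ∃ S : Set V, IsProperFuzzyOddSubdivision (G.induce S) H := by
  classical
  have := Fintype.ofFinite W
  -- One orientation is chosen per edge, so that no edge receives two routes.
  set E : Finset (W × W) := Finset.univ.image fun e : H.edgeSet => Quot.out (e : Sym2 W) with hE
  have hout : ∀ e : H.edgeSet, s((Quot.out (e : Sym2 W)).1, (Quot.out (e : Sym2 W)).2) = (e : Sym2 W) :=
    fun e => Quot.out_eq _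
  have hEmem : ∀ e : H.edgeSet, Quot.out (e : Sym2 W) ∈ E := fun e =>
    Finset.mem_image_of_mem _ (Finset.mem_univ e)
  obtain ⟨N, m, hroutes⟩ := exists_routes Finset.univ E (by
    intro f hf
    obtain ⟨e, -, rfl⟩ := Finset.mem_image.1 hf
    refine ⟨Finset.mem_univ _, Finset.mem_univ _, ?_⟩
    have he := e.2
    rw [← hout e, SimpleGraph.mem_edgeSet] at he
    exact he.ne)
  obtain ⟨k, m₀, hcfg⟩ := exists_cfg (Finset.univ : Finset W) N m
  -- With `ε = δ = κ⁻¹` and target mass `(m₀ + 1) * κ⁻¹`, the mass needed for `k` common covers is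
  -- exactly 1. The `+ 1` keeps the target at least `ε` and `δ` even when `m₀ = 0`.
  set κ : ℝ := 2 ^ k * (2 * ((r + 3) ^ (2 ^ k) * (m₀ + 1))) with hκ
  have hκpos : 0 < κ := by positivity
  refine ⟨κ⁻¹, inv_pos.2 hκpos, κ⁻¹, inv_pos.2 hκpos, fun V _ G μ hμ hf hc => ?_⟩
  have hle : κ⁻¹ ≤ (m₀ + 1) * κ⁻¹ :=
    le_mul_of_one_le_left (inv_pos.2 hκpos).le (by linarith [(Nat.cast_nonneg m₀ : (0 : ℝ) ≤ m₀)])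
  obtain ⟨M, D, hM, hD, hcov, hsep⟩ := exists_common_covers hμ hc hf hle hle k (by
    rw [show (2 : ℝ) ^ k * (2 * ((r + 3) ^ (2 ^ k) * ((m₀ + 1) * κ⁻¹))) = κ * κ⁻¹ by rw [hκ]; ring,
      mul_inv_cancel₀ hκpos.ne'])
  obtain ⟨x, p, C, P, M', hC, hCN, hM'⟩ := hcfg V (Set V × Set V) G μ κ⁻¹ hμ hc D Prod.fst Prod.snd M
    hD hcov hsep (by linarith [inv_pos.2 hκpos])
  obtain ⟨I, hI⟩ := hroutes V (Set V × Set V) G μ κ⁻¹ hμ hc x Prod.fst p C P M' hC hCN hM'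
  refine exists_isProperFuzzyOddSubdivision (H := H) (x := x)
    (fun a b h => hC.inj a (Finset.mem_univ _) b (Finset.mem_univ _) h)
    (fun a b => hC.stable a (Finset.mem_univ _) b (Finset.mem_univ _))
    (fun e => I (Quot.out (e : Sym2 W))) ?_ ?_ ?_
  · intro a b h
    have h1 := (hI _ (hEmem ⟨s(a, b), h⟩)).1
    have h2 := hout ⟨s(a, b), h⟩
    rcases Sym2.eq_iff.1 h2 with ⟨ha, hb⟩ | ⟨ha, hb⟩
    · rwa [ha, hb] at h1
    · rw [ha, hb] at h1
      exact h1.symm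
  · intro e w hw
    refine (hI _ (hEmem e)).2.2.1 w (Finset.mem_univ w) ?_ ?_ <;> intro h <;> apply hw <;>
      rw [← hout e, Sym2.mem_iff]
    exacts [Or.inl h, Or.inr h]
  · intro e f hef
    refine (hI _ (hEmem e)).2.2.2 _ (hEmem f) fun h => hef (Subtype.ext ?_)
    rw [← hout e, ← hout f, h]
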